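/- Let $d\in\{2,3\}$, let $\Gamma\subset\mathbb R^d$ be an embedded hypersurface of class $C^2$, and let $\sigma>0$. There exist constants $h_0>0$ and $C>0$, depending only on $\Gamma$ and $\sigma$, such that the following holds. Let $\Omega\subset\mathbb R^d$ be any bounded convex open polygonal ($d=2$) or polyhedral ($d=3$) domain which is the disjoint union $\Omega=\Omega_1\cup\Gamma\cup\Omega_2$, where $\Omega_1,\Omega_2$ are disjoint open sets and $\Gamma=\partial\Omega_1\cap\partial\Omega_2$. Let $\mathcal M_h$ be any conforming partition of $\overline\Omega$ into finitely many closed triangles and parallelograms ($d=2$), respectively tetrahedra and parallelepipeds ($d=3$), which is shape regular with constant $\sigma$, that is, every element $K$ contains a ball of diameter $h_K/\sigma$, where $h_K=\operatorname{diam}K$. Suppose that $h=\max_{K\in\mathcal M_h}h_K\le h_0$. Let $e$ be any interface segment/patch and $K^e\in\mathcal M_h$ an element containing it; that is, either $\Gamma$ meets the interior of $K^e$ and $e=\Gamma\cap K^e$, or $e\subset\Gamma$ is a common $(d-1)$-dimensional face of $K^e$ and of another element of $\mathcal M_h$. Put $K^e_i=K^e\cap\Omega_i$ for $i=1,2$.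 Then there is $i_e\in\{1,2\}$ such that both of the following hold. (i) Every $v\in H^1(K^e_{i_e})$ has a trace on $e$ in $L^2(e)$ (the limit in $L^2(e)$ of the restrictions to $e$ of functions in $C^\infty(\mathbb R^d)$ that converge to $v$ in $H^1(K^e_{i_e})$), and, denoting the trace again by $v$, $$\|v\|_{L^2(e)}\le C\Big(h_{K^e}^{-1/2}\|v\|_{L^2(K^e_{i_e})}+\|v\|_{L^2(K^e_{i_e})}^{1/2}\,\|\nabla v\|_{L^2(K^e_{i_e})}^{1/2}\Big).$$ (ii) For every integer $p\ge 1$ and every $v_h\in\mathcal P_p(K^e)$, $$\|v_h\|_{L^2(e)}\le C\,\frac{p}{h_{K^e}^{1/2}}\,\|v_h\|_{L^2(K^e_{i_e})}.$$ Here $\mathcal P_p(K)$ consists of the real polynomials of total degree at most $p$ if $K$ is a triangle or tetrahedron, and of the polynomials of degree at most $p$ in each variable if $K$ is a parallelogram or parallelepiped, the variables being either the Cartesian coordinates or the coordinates along the edges of $K$ (the estimate holds for both choices). The norm of $L^2(e)$ is taken with respect to the $(d-1)$-dimensional surface measure. -/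

import Mathlib

open MeasureTheory Filter Topology Set
open scoped ENNReal ContDiff Gradient

namespace Interface

/-- Euclidean space `ℝᵈ`. -/
abbrev E (d : ℕ) : Type := EuclideanSpace ℝ (Fin d)

/-! ### The interface and the two subdomains -/

/-- `Γ` is an embedded hypersurface of class `C²`: near each of its points it is the zero set of a
`C²` function with nonvanishing differential. -/
def IsC2Hypersurface {d : ℕ} (Γ : Set (E d)) : Prop :=
  ∀ x ∈ Γ, ∃ (U : Set (E d)) (φ : E d → ℝ), IsOpen U ∧ x ∈ U ∧ ContDiffOn ℝ 2 φ U ∧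
    fderiv ℝ φ x ≠ 0 ∧ Γ ∩ U = {y ∈ U | φ y = 0}

/-- `Ω` is a bounded convex polygonal/polyhedral domain, disjoint union of the open sets `Ωs 0`,
`Ωs 1` and of the set `Γ`, where `Γ = ∂(Ωs 0) ∩ ∂(Ωs 1)`. -/
structure IsInterfaceSplitting {d : ℕ} (Ω : Set (E d)) (Ωs : Fin 2 → Set (E d))
    (Γ : Set (E d)) : Prop where
  isOpen : IsOpen Ω
  convex : Convex ℝ Ω
  polytope : ∃ S : Finset (E d), closure Ω = convexHull ℝ (S : Set (E d))
  isOpen_part : ∀ i, IsOpen (Ωs i)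
  disjoint : Disjoint (Ωs 0) (Ωs 1)
  union_eq : Ω = Ωs 0 ∪ Γ ∪ Ωs 1
  interface_eq : Γ = frontier (Ωs 0) ∩ frontier (Ωs 1)

/-! ### Elements, local polynomials, meshes -/

/-- Closed nondegenerate `d`-simplex (triangle, tetrahedron). -/
def IsSimplex {d : ℕ} (K : Set (E d)) : Prop :=
  ∃ a : Fin (d + 1) → E d, AffineIndependent ℝ a ∧ K = convexHull ℝ (range a)

/-- `K` is the closed nondegenerate parallelepiped with vertex `x₀` and edge vectors `b`. -/
def IsParallelepipedWith {d : ℕ} (K : Set (E d)) (x₀ : E d) (b : Fin d → E d) : Prop :=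
  LinearIndependent ℝ b ∧ K = (fun x => x₀ + x) '' parallelepiped b

/-- Closed nondegenerate parallelepiped (parallelogram if `d = 2`). -/
def IsParallelepiped {d : ℕ} (K : Set (E d)) : Prop :=
  ∃ x₀ b, IsParallelepipedWith K x₀ b

/-- The local polynomials of degree `p` on an element `K`: total degree at most `p` on a simplex;
separate degrees at most `p` on a parallelepiped, where the variables may be either the Cartesian
coordinates of `ℝᵈ` or the coordinates along the edges of `K` (both conventions are covered). -/
inductive IsLocalPolynomial {d : ℕ} (K : Set (E d)) (p : ℕ) (v : E d → ℝ) : Prop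
  | simplex (hK : IsSimplex K) (q : MvPolynomial (Fin d) ℝ) (hq : q.totalDegree ≤ p)
      (hv : ∀ x : E d, v x = MvPolynomial.eval (fun i => x i) q)
  | cartesian (hK : IsParallelepiped K) (q : MvPolynomial (Fin d) ℝ)
      (hq : ∀ i, q.degreeOf i ≤ p)
      (hv : ∀ x : E d, v x = MvPolynomial.eval (fun i => x i) q)
  | edge (x₀ : E d) (b : Fin d → E d) (hK : IsParallelepipedWith K x₀ b)
      (q : MvPolynomial (Fin d) ℝ) (hq : ∀ i, q.degreeOf i ≤ p)
      (hv : ∀ t : Fin d → ℝ, v (x₀ + ∑ i, t i • b i) = MvPolynomial.eval t q)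

/-- Conforming partition of `closure Ω` into finitely many closed simplices and parallelepipeds:
they do not overlap, and any two distinct ones meet in a (possibly empty) common face. -/
structure IsConformingMesh {d : ℕ} (Ω : Set (E d)) (M : Set (Set (E d))) : Prop where
  finite : M.Finite
  element : ∀ K ∈ M, IsSimplex K ∨ IsParallelepiped K
  cover : ⋃₀ M = closure Ω
  disjoint_interior : ∀ K ∈ M, ∀ K' ∈ M, K ≠ K' → Disjoint (interior K) (interior K')
  common_face : ∀ K ∈ M, ∀ K' ∈ M, K ≠ K' → IsExposed ℝ K (K ∩ K')

/-- The mesh size `h`, the largest diameter of an element. -/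
noncomputable def meshSize {d : ℕ} (M : Set (Set (E d))) : ℝ := sSup (Metric.diam '' M)

/-- Shape regularity with constant `σ`: each element `K` contains a ball of diameter
`h_K / σ`, that is `h_K ≤ σ ρ_K` with `ρ_K` the diameter of the largest ball in `K`. -/
def IsShapeRegular {d : ℕ} (σ : ℝ) (M : Set (Set (E d))) : Prop :=
  ∀ K ∈ M, ∃ c, Metric.closedBall c (Metric.diam K / (2 * σ)) ⊆ K

/-- `e` is one of the pieces (segments, patches) into which the mesh `M` cuts the interface `Γ`,
and `K` is an element of `M` containing it: either `Γ` meets the interior of `K` and `e = Γ ∩ K`,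
or `e ⊆ Γ` is a common `(d-1)`-dimensional face of `K` and another element. -/
def IsInterfacePiece {d : ℕ} (Γ : Set (E d)) (M : Set (Set (E d))) (K e : Set (E d)) : Prop :=
  K ∈ M ∧
    (((Γ ∩ interior K).Nonempty ∧ e = Γ ∩ K) ∨
      (∃ K' ∈ M, K' ≠ K ∧ e = K ∩ K' ∧ e ⊆ Γ ∧ Module.finrank ℝ (vectorSpan ℝ e) + 1 = d))

/-! ### Function spaces and norms -/

/-- `G` is the weak gradient of `v` in the open set `D`. -/
def HasWeakGradient {d : ℕ} (D : Set (E d)) (v : E d → ℝ) (G : E d → E d) : Prop :=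
  ∀ φ : E d → ℝ, ContDiff ℝ ∞ φ → HasCompactSupport φ → tsupport φ ⊆ D → ∀ w : E d,
    ∫ x in D, v x * fderiv ℝ φ x w = -∫ x in D, inner ℝ (G x) w * φ x

/-- `v ∈ H¹(D)`, with weak gradient `G`. -/
structure MemH1 {d : ℕ} (D : Set (E d)) (v : E d → ℝ) (G : E d → E d) : Prop where
  memLp : MemLp v 2 (volume.restrict D)
  memLp_grad : MemLp G 2 (volume.restrict D)
  hasWeakGradient : HasWeakGradient D v G

/-- Surface measure on a piece `e` of hypersurface: the `(d-1)`-dimensional Hausdorff measure,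
normalized to agree with Lebesgue measure on hyperplanes. -/
noncomputable def surfaceMeasure {d : ℕ} (e : Set (E d)) : Measure (E d) :=
  (Measure.euclideanHausdorffMeasure (d - 1)).restrict e

/-- `g ∈ L²(e)` is the trace on `e` of the function `v ∈ H¹(D)` with weak gradient `G`: some
functions smooth up to the boundary converge to `v` in `H¹(D)`, and their restrictions to `e`
converge to `g` in `L²(e)`. -/
def IsTrace {d : ℕ} (D e : Set (E d)) (v : E d → ℝ) (G : E d → E d) (g : E d → ℝ) : Prop :=
  MemLp g 2 (surfaceMeasure e) ∧
    ∃ u : ℕ → E d → ℝ, (∀ n, ContDiff ℝ ∞ (u n)) ∧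
      Tendsto (fun n => eLpNorm (u n - v) 2 (volume.restrict D)) atTop (𝓝 0) ∧
      Tendsto (fun n => eLpNorm (∇ (u n) - G) 2 (volume.restrict D)) atTop (𝓝 0) ∧
      Tendsto (fun n => eLpNorm (u n - g) 2 (surfaceMeasure e)) atTop (𝓝 0)

end Interface

namespace Interface

/-! ### Flatness of compact hypersurfaces -/

/-! The whole estimate is obtained by integrating along rays issuing from one well-chosen point `z`
in the interior of the element `K`.

Flatness. If a splitting exists, `Γ` is compact, so below a uniform scale `δ` it deviates from a
hyperplane by an arbitrarily small slope. In an element of diameter `h` below that scale, start from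
the centre of the inscribed ball and move by `h / (4σ)` away from the hyperplane. From the resulting
`z`, all of `Γ ∩ K` lies at height at least `h / (8σ)` while its slope is at most `1 / (16σ)`. Hence
each ray from `z` meets `Γ ∩ K` at most once (`IsTransversal.eq_of_mem`). In particular `z ∉ Γ`, and
the index sought is that of the part `Ωs i` containing `z`.

Geometry. A ray cannot leave `Ωs i` before it meets `Γ`, and it cannot touch `Γ` and come back. So
`interior K ∩ Ωs i` contains the open segments from `z` to `Γ ∩ K` (`cone_subset`) and is strictly
star-shaped about `z` (`starShaped_closure`).

Analysis. Parametrizing `e` by central projection from `z`, an integral over `e` of weighted ray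
integrals with weight `t ^ (d - 1)` is bounded by `1 / h` times an integral over the cone
(`IsTransversal.lintegral_cone_le`). It then suffices to bound the square of the value at the end of
a ray by a weighted ray integral. For smooth functions this is the fundamental theorem of calculus
(`sq_le_integral_ray`); for polynomials it is a sharp one-dimensional inverse inequality whose
constant is quadratic in the degree (`sq_eval_one_le`). Dilation towards `z` followed by
mollification makes smooth functions dense in `H¹`, and the trace and its bound follow by
completeness of `L²(e)`. -/

theorem IsC2Hypersurface.exists_normal {d : ℕ} {Γ : Set (E d)} (hΓ : IsC2Hypersurface Γ)
    {ε : ℝ} (hε : 0 < ε) {x : E d} (hx : x ∈ Γ) :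
    ∃ n : E d, ‖n‖ = 1 ∧ ∃ δ > 0, ∀ y ∈ Γ ∩ Metric.ball x δ, ∀ y' ∈ Γ ∩ Metric.ball x δ,
      |inner ℝ n (y - y')| ≤ ε * ‖y - y'‖ := by
  obtain ⟨U, φ, hU, hxU, hφ, hd, hΓU⟩ := hΓ x hx
  have hst : HasStrictFDerivAt φ (fderiv ℝ φ x) x :=
    (hφ.contDiffAt (hU.mem_nhds hxU)).hasStrictFDerivAt (by norm_num)
  set g : E d := (InnerProductSpace.toDual ℝ (E d)).symm (fderiv ℝ φ x) with hg
  have hgi : ∀ w, inner ℝ g w = fderiv ℝ φ x w := fun w =>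
    InnerProductSpace.toDual_symm_apply
  have hg0 : 0 < ‖g‖ := by
    rw [hg, LinearIsometryEquiv.norm_map]; exact norm_pos_iff.2 hd
  have hlo := hst.isLittleO.def (mul_pos hε hg0)
  obtain ⟨δ₁, hδ₁, h₁⟩ := Metric.eventually_nhds_iff_ball.1 hlo
  obtain ⟨δ₂, hδ₂, h₂⟩ := Metric.isOpen_iff.1 hU x hxU
  have hzero : ∀ y ∈ Γ ∩ Metric.ball x (min δ₁ δ₂), φ y = 0 := fun y hy =>
    ((Set.ext_iff.1 hΓU y).1
      ⟨hy.1, h₂ (Metric.ball_subset_ball (min_le_right _ _) hy.2)⟩).2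
  refine ⟨‖g‖⁻¹ • g, ?_, min δ₁ δ₂, lt_min hδ₁ hδ₂, fun y hy y' hy' => ?_⟩
  · rw [norm_smul, norm_inv, norm_norm, inv_mul_cancel₀ hg0.ne']
  · have hm : (y, y') ∈ Metric.ball (x, x) δ₁ := by
      rw [← ball_prod_same]
      exact ⟨Metric.ball_subset_ball (min_le_left _ _) hy.2,
        Metric.ball_subset_ball (min_le_left _ _) hy'.2⟩
    -- Strict differentiability compares two points at once: `φ` vanishes at both, so only the
    -- linear term is left and it must be small.
    have := h₁ (y, y') hm
    simp only [hzero y hy, hzero y' hy', sub_self, zero_sub, norm_neg, Real.norm_eq_abs] at this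
    rw [real_inner_smul_left, hgi, abs_mul, abs_inv, abs_norm, inv_mul_le_iff₀ hg0]
    linarith [this]

/-- A Lebesgue number of the cover by the local balls makes the scale independent of the point. -/
theorem IsC2Hypersurface.exists_uniform_normal {d : ℕ} {Γ : Set (E d)} (hΓ : IsC2Hypersurface Γ)
    (hc : IsCompact Γ) {ε : ℝ} (hε : 0 < ε) :
    ∃ δ > 0, ∀ x ∈ Γ, ∃ n : E d, ‖n‖ = 1 ∧ ∀ y ∈ Γ ∩ Metric.ball x δ,
      ∀ y' ∈ Γ ∩ Metric.ball x δ, |inner ℝ n (y - y')| ≤ ε * ‖y - y'‖ := by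
  choose! n hn δ hδ h using fun x (hx : x ∈ Γ) => hΓ.exists_normal hε hx
  obtain ⟨η, hη, hL⟩ := lebesgue_number_lemma_of_metric (ι := {x // x ∈ Γ})
    (c := fun x => Metric.ball x.1 (δ x.1)) hc (fun _ => Metric.isOpen_ball)
    (fun x hx => mem_iUnion.2 ⟨⟨x, hx⟩, Metric.mem_ball_self (hδ x hx)⟩)
  refine ⟨η, hη, fun x hx => ?_⟩
  obtain ⟨i, hi⟩ := hL x hx
  exact ⟨n i, hn i i.2, fun y hy y' hy' => h i i.2 y ⟨hy.1, hi hy.2⟩ y' ⟨hy'.1, hi hy'.2⟩⟩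

/-! ### A sharp inverse inequality in one variable -/

section OneVariable

open Polynomial

theorem integral_mul_derivative (P Q : ℝ[X]) :
    ∫ t in (0 : ℝ)..1, (P * derivative Q).eval t =
      P.eval 1 * Q.eval 1 - P.eval 0 * Q.eval 0 -
        ∫ t in (0 : ℝ)..1, (derivative P * Q).eval t := by
  simp only [eval_mul]
  exact intervalIntegral.integral_mul_deriv_eq_deriv_mul (u := fun t => P.eval t)
    (v := fun t => Q.eval t) (u' := fun t => (derivative P).eval t)
    (v' := fun t => (derivative Q).eval t)
    (fun t _ => P.hasDerivAt t) (fun t _ => Q.hasDerivAt t)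
    ((derivative P).continuous.intervalIntegrable _ _)
    ((derivative Q).continuous.intervalIntegrable _ _)

/-- The polynomial whose derivative of order `N + 1` represents, up to a factor, the evaluation
at `1` on polynomials of degree at most `N`. -/
noncomputable def endpointWeight (N : ℕ) : ℝ[X] := X ^ (N + 1) * (X - 1) ^ N

theorem taylor_endpointWeight (N : ℕ) :
    taylor 1 (endpointWeight N) = (X + 1) ^ (N + 1) * X ^ N := by
  simp [endpointWeight, taylor_mul, taylor_pow]

theorem eval_one_iterate_derivative (P : ℝ[X]) (k : ℕ) :
    (derivative^[k] P).eval 1 = k.factorial * (taylor 1 P).coeff k := by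
  rw [taylor_coeff, ← factorial_smul_hasseDeriv]
  simp

theorem endpointWeight_eval_zero {N k : ℕ} (hk : k ≤ N) :
    (derivative^[k] (endpointWeight N)).eval 0 = 0 := by
  have h : (X : ℝ[X]) ^ (N + 1 - k) ∣ derivative^[k] (endpointWeight N) :=
    pow_sub_dvd_iterate_derivative_of_pow_dvd k ⟨_, rfl⟩
  have h' : (X : ℝ[X]) ∣ derivative^[k] (endpointWeight N) :=
    (dvd_pow_self X (by omega)).trans h
  obtain ⟨R, hR⟩ := h'
  rw [hR]; simp

theorem endpointWeight_eval_one_of_lt {N k : ℕ} (hk : k < N) :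
    (derivative^[k] (endpointWeight N)).eval 1 = 0 := by
  rw [eval_one_iterate_derivative, taylor_endpointWeight, coeff_mul_X_pow', if_neg (by omega),
    mul_zero]

theorem endpointWeight_eval_one (N : ℕ) :
    (derivative^[N] (endpointWeight N)).eval 1 = N.factorial := by
  rw [eval_one_iterate_derivative, taylor_endpointWeight, coeff_mul_X_pow', if_pos le_rfl,
    Nat.sub_self, ← C_1, coeff_X_add_C_pow]
  simp

theorem endpointWeight_eval_one_succ (N : ℕ) :
    (derivative^[N + 1] (endpointWeight N)).eval 1 = N.factorial * ((N : ℝ) + 1) ^ 2 := by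
  rw [eval_one_iterate_derivative, taylor_endpointWeight, coeff_mul_X_pow', if_pos (by omega),
    Nat.add_sub_cancel_left, ← C_1, coeff_X_add_C_pow, Nat.factorial_succ]
  simp
  ring

/-- Repeated integration by parts: the weight vanishes to order `N + 1` at `0` and `N` at `1`, so no
boundary term appears in the first `N` steps. -/
theorem integral_mul_iterate_derivative_endpointWeight {N k : ℕ} (hk : k ≤ N) (Q : ℝ[X]) :
    ∫ t in (0 : ℝ)..1, (Q * derivative^[k] (endpointWeight N)).eval t =
      (-1) ^ k * ∫ t in (0 : ℝ)..1, (derivative^[k] Q * endpointWeight N).eval t := by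
  induction k generalizing Q with
  | zero => simp
  | succ k ih =>
    rw [Function.iterate_succ_apply', integral_mul_derivative,
      endpointWeight_eval_zero (by omega : k ≤ N), endpointWeight_eval_one_of_lt (by omega : k < N),
      ih (by omega), ← Function.iterate_succ_apply derivative]
    ring

/-- The representer of the evaluation at `1` among polynomials of degree at most `N`. -/
theorem integral_mul_endpoint {N : ℕ} {Q : ℝ[X]} (hQ : Q.natDegree ≤ N) :
    ∫ t in (0 : ℝ)..1, (Q * derivative^[N + 1] (endpointWeight N)).eval t =
      N.factorial * Q.eval 1 := by
  have h0 : derivative^[N + 1] Q = 0 := iterate_derivative_eq_zero (by omega)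
  rw [Function.iterate_succ_apply', integral_mul_derivative, endpointWeight_eval_zero le_rfl,
    endpointWeight_eval_one, integral_mul_iterate_derivative_endpointWeight le_rfl,
    ← Function.iterate_succ_apply derivative, h0]
  simp [mul_comm]

/-- Cauchy–Schwarz against the representer `S` of the evaluation at `1`. Since `S` itself has degree
at most `N`, the representation applied to `S` computes its own norm. -/
theorem sq_eval_one_le {N : ℕ} {Q : ℝ[X]} (hQ : Q.natDegree ≤ N) :
    Q.eval 1 ^ 2 ≤ ((N : ℝ) + 1) ^ 2 * ∫ t in (0 : ℝ)..1, Q.eval t ^ 2 := by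
  set S := derivative^[N + 1] (endpointWeight N)
  have hf : (0 : ℝ) < N.factorial := by positivity
  have hS : S.natDegree ≤ N := by
    refine (natDegree_iterate_derivative _ _).trans ?_
    have : (endpointWeight N).natDegree ≤ (N + 1) + N := by
      rw [endpointWeight, ← C_1]
      compute_degree
    omega
  set M : ℝ := ((N : ℝ) + 1) ^ 2 with hM
  have hM0 : 0 < M := by positivity
  have h1 := integral_mul_endpoint hQ
  have h2 := integral_mul_endpoint hS
  rw [endpointWeight_eval_one_succ] at h2
  simp only [eval_mul] at h1 h2
  set a : ℝ := Q.eval 1 / (N.factorial * M) with ha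
  have hint : ∀ P : ℝ[X], IntervalIntegrable (fun t => P.eval t) volume 0 1 := fun P =>
    P.continuous.intervalIntegrable _ _
  have hpos : 0 ≤ ∫ t in (0 : ℝ)..1, (Q.eval t - a * S.eval t) ^ 2 :=
    intervalIntegral.integral_nonneg (by norm_num) fun t _ => sq_nonneg _
  have hexp : ∫ t in (0 : ℝ)..1, (Q.eval t - a * S.eval t) ^ 2 =
      (∫ t in (0 : ℝ)..1, Q.eval t ^ 2) - 2 * a * (N.factorial * Q.eval 1) +
        a ^ 2 * (N.factorial * (N.factorial * M)) := by
    rw [← h1, ← h2, ← intervalIntegral.integral_const_mul, ← intervalIntegral.integral_const_mul,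
      ← intervalIntegral.integral_sub, ← intervalIntegral.integral_add]
    · congr 1; ext t; ring
    · exact (by fun_prop : Continuous fun t => _).intervalIntegrable _ _
    · exact (by fun_prop : Continuous fun t => _).intervalIntegrable _ _
    · exact (by fun_prop : Continuous fun t => _).intervalIntegrable _ _
    · exact (by fun_prop : Continuous fun t => _).intervalIntegrable _ _
  rw [hexp] at hpos
  have e1 : 2 * a * (N.factorial * Q.eval 1) = 2 * (Q.eval 1 ^ 2 / M) := by
    rw [ha]; field_simp
  have e2 : a ^ 2 * (N.factorial * (N.factorial * M)) = Q.eval 1 ^ 2 / M := by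
    rw [ha]; field_simp
  rw [e1, e2] at hpos
  have : Q.eval 1 ^ 2 / M ≤ ∫ t in (0 : ℝ)..1, Q.eval t ^ 2 := by linarith
  rwa [div_le_iff₀' hM0] at this

/-- On `[0, 1]` one has `t ^ 2 ≤ t ^ m` for `m ≤ 2`, so the weight is absorbed by passing from `Q`
to `X * Q`, at the cost of one degree. This is where `d ≤ 3` enters. -/
theorem sq_eval_one_le_weighted {N m : ℕ} (hm : m ≤ 2) {Q : ℝ[X]} (hQ : Q.natDegree ≤ N) :
    Q.eval 1 ^ 2 ≤ ((N : ℝ) + 2) ^ 2 * ∫ t in (0 : ℝ)..1, t ^ m * Q.eval t ^ 2 := by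
  have hd : (X * Q).natDegree ≤ N + 1 := by
    refine natDegree_mul_le.trans ?_
    have := natDegree_X_le (R := ℝ)
    omega
  have h := sq_eval_one_le hd
  have h' : ∫ t in (0 : ℝ)..1, (X * Q).eval t ^ 2 ≤ ∫ t in (0 : ℝ)..1, t ^ m * Q.eval t ^ 2 := by
    refine intervalIntegral.integral_mono_on (by norm_num)
      ((by fun_prop : Continuous fun t => _).intervalIntegrable _ _)
      ((by fun_prop : Continuous fun t => _).intervalIntegrable _ _) fun t ht => ?_
    rw [eval_mul, eval_X, mul_pow]
    exact mul_le_mul_of_nonneg_right (pow_le_pow_of_le_one ht.1 ht.2 hm) (sq_nonneg _)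
  rw [eval_mul, eval_X, one_mul] at h
  push_cast at h
  calc _ ≤ _ := h
    _ ≤ _ := by
      rw [add_assoc, one_add_one_eq_two]
      gcongr

theorem ofReal_sq_eval_one_le {N m : ℕ} (hm : m ≤ 2) {Q : ℝ[X]} (hQ : Q.natDegree ≤ N) :
    ENNReal.ofReal (Q.eval 1 ^ 2) ≤ ENNReal.ofReal (((N : ℝ) + 2) ^ 2) *
      ∫⁻ t in Ioo (0 : ℝ) 1, ENNReal.ofReal (t ^ m) * ENNReal.ofReal (Q.eval t ^ 2) := by
  have h := sq_eval_one_le_weighted hm hQ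
  have hc : Continuous fun t : ℝ => t ^ m * Q.eval t ^ 2 := by fun_prop
  rw [intervalIntegral.integral_of_le zero_le_one, integral_Ioc_eq_integral_Ioo] at h
  refine (ENNReal.ofReal_le_ofReal h).trans ?_
  rw [ENNReal.ofReal_mul (by positivity)]
  refine mul_le_mul_right ?_ _
  rw [ofReal_integral_eq_lintegral_ofReal
    (hc.integrableOn_Icc.mono_set Ioo_subset_Icc_self)
    (ae_restrict_of_forall_mem measurableSet_Ioo fun t ht => by
      have := ht.1.le
      positivity)]
  refine (setLIntegral_congr_fun measurableSet_Ioo fun t ht => ?_).le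
  exact ENNReal.ofReal_mul (pow_nonneg ht.1.le _)

end OneVariable

/-! ### Interface splittings -/

namespace IsInterfaceSplitting

variable {d : ℕ} {Ω : Set (E d)} {Ωs : Fin 2 → Set (E d)} {Γ : Set (E d)}

theorem union_eq_of_ne (S : IsInterfaceSplitting Ω Ωs Γ) {i j : Fin 2} (hij : i ≠ j) :
    Ω = Ωs i ∪ Γ ∪ Ωs j := by
  have h := S.union_eq
  fin_cases i <;> fin_cases j <;> simp at hij ⊢
  · exact h
  · rw [h]; ext; simp only [mem_union]; tauto

theorem disjoint_of_ne (S : IsInterfaceSplitting Ω Ωs Γ) {i j : Fin 2} (hij : i ≠ j) :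
    Disjoint (Ωs i) (Ωs j) := by
  fin_cases i <;> fin_cases j <;> simp at hij ⊢
  · exact S.disjoint
  · exact S.disjoint.symm

theorem interface_subset_frontier (S : IsInterfaceSplitting Ω Ωs Γ) (i : Fin 2) :
    Γ ⊆ frontier (Ωs i) := by
  rw [S.interface_eq]
  fin_cases i
  · exact inter_subset_left
  · exact inter_subset_right

theorem notMem_interface (S : IsInterfaceSplitting Ω Ωs Γ) {i : Fin 2} {x : E d}
    (hx : x ∈ Ωs i) : x ∉ Γ := fun h =>
  ((S.isOpen_part i).inter_frontier_eq ▸ ⟨hx, S.interface_subset_frontier i h⟩ :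
    x ∈ (∅ : Set (E d)))

theorem interface_subset (S : IsInterfaceSplitting Ω Ωs Γ) : Γ ⊆ Ω := by
  rw [S.union_eq]; exact fun x hx => Or.inl (Or.inr hx)

theorem isBounded (S : IsInterfaceSplitting Ω Ωs Γ) : Bornology.IsBounded Ω := by
  obtain ⟨F, hF⟩ := S.polytope
  exact ((isBounded_convexHull.2 F.finite_toSet.isBounded).subset hF.le).subset subset_closure

theorem isCompact_interface (S : IsInterfaceSplitting Ω Ωs Γ) : IsCompact Γ := by
  refine Metric.isCompact_of_isClosed_isBounded ?_ (S.isBounded.subset S.interface_subset)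
  rw [S.interface_eq]
  exact isClosed_frontier.inter isClosed_frontier

theorem exists_mem_part (S : IsInterfaceSplitting Ω Ωs Γ) {x : E d} (hx : x ∈ Ω) (hΓ : x ∉ Γ) :
    ∃ i, x ∈ Ωs i := by
  rw [S.union_eq] at hx
  rcases hx with (h | h) | h
  exacts [⟨0, h⟩, absurd h hΓ, ⟨1, h⟩]

theorem subset_part (S : IsInterfaceSplitting Ω Ωs Γ) {T : Set (E d)} (hT : IsPreconnected T)
    (hTΩ : T ⊆ Ω) (hTΓ : Disjoint T Γ) {i : Fin 2} {x : E d} (hxT : x ∈ T) (hx : x ∈ Ωs i) :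
    T ⊆ Ωs i := by
  obtain ⟨j, hij⟩ := exists_ne i
  refine hT.subset_left_of_subset_union (S.isOpen_part i) (S.isOpen_part j)
    (S.disjoint_of_ne hij.symm) (fun y hy => ?_) ⟨x, hxT, hx⟩
  have := hTΩ hy
  rw [S.union_eq_of_ne hij.symm] at this
  rcases this with (h | h) | h
  exacts [Or.inl h, (disjoint_left.1 hTΓ hy h).elim, Or.inr h]

theorem exists_mem_segment (S : IsInterfaceSplitting Ω Ωs Γ) {i j : Fin 2} (hij : i ≠ j)
    {a b : E d} (ha : a ∈ Ωs i) (hb : b ∈ Ωs j) (hab : segment ℝ a b ⊆ Ω) :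
    ∃ x ∈ segment ℝ a b, x ∈ Γ := by
  by_contra! h
  have := S.subset_part (convex_segment a b).isPreconnected hab (disjoint_left.2 h)
    (left_mem_segment ℝ a b) ha (right_mem_segment ℝ a b)
  exact disjoint_left.1 (S.disjoint_of_ne hij) this hb

theorem mem_part_of_mem_closure (S : IsInterfaceSplitting Ω Ωs Γ) {i : Fin 2} {x : E d}
    (hx : x ∈ closure (Ωs i)) (hΩ : x ∈ Ω) (hΓ : x ∉ Γ) : x ∈ Ωs i := by
  obtain ⟨j, hj⟩ := S.exists_mem_part hΩ hΓ
  by_cases hij : i = j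
  · exact hij ▸ hj
  · exact (disjoint_left.1 ((S.disjoint_of_ne hij).closure_left (S.isOpen_part j)) hx hj).elim

end IsInterfaceSplitting

/-! ### Nearly flat sets seen from a point -/

/-- The set `e` is nearly flat with approximate normal `n`, and every ray from `z` meets it at an
angle bounded from below; `h` measures its distance from `z`. -/
structure IsTransversal {d : ℕ} (e : Set (E d)) (z n : E d) (c h : ℝ) : Prop where
  norm_eq : ‖n‖ = 1
  c_pos : 0 < c
  h_pos : 0 < h
  height : ∀ x ∈ e, c * h ≤ inner ℝ n (x - z)
  dist_le : ∀ x ∈ e, ‖x - z‖ ≤ h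
  flat : ∀ x ∈ e, ∀ y ∈ e, |inner ℝ n (x - y)| ≤ c / 2 * ‖x - y‖

namespace IsTransversal

variable {d : ℕ} {e : Set (E d)} {z n : E d} {c h : ℝ}

theorem mono (T : IsTransversal e z n c h) {e' : Set (E d)} (he : e' ⊆ e) :
    IsTransversal e' z n c h :=
  ⟨T.norm_eq, T.c_pos, T.h_pos, fun x hx => T.height x (he hx), fun x hx => T.dist_le x (he hx),
    fun x hx y hy => T.flat x (he hx) y (he hy)⟩

theorem notMem (T : IsTransversal e z n c h) : z ∉ e := fun hz => by
  have := T.height z hz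
  rw [sub_self, inner_zero_right] at this
  nlinarith [mul_pos T.c_pos T.h_pos]

/-- Two distinct points on a ray would force its direction to be nearly orthogonal to `n`; the
height of a point at distance at most `h` would then be at most `c * h / 2`. -/
theorem eq_of_mem (T : IsTransversal e z n c h) {w : E d} {s t : ℝ} (hs : z + s • w ∈ e)
    (ht : z + t • w ∈ e) : s = t := by
  by_contra hne
  have h1 := T.height _ hs
  have h2 := T.dist_le _ hs
  have h3 := T.flat _ hs _ ht
  have e1 : z + s • w - (z + t • w) = (s - t) • w := by rw [sub_smul]; abel
  rw [add_sub_cancel_left, real_inner_smul_right] at h1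
  rw [add_sub_cancel_left, norm_smul, Real.norm_eq_abs] at h2
  rw [e1, real_inner_smul_right, abs_mul, norm_smul, Real.norm_eq_abs] at h3
  have hpos : 0 < |s - t| := abs_pos.2 (sub_ne_zero.2 hne)
  have h4 : |inner ℝ n w| ≤ c / 2 * ‖w‖ := by
    refine le_of_mul_le_mul_left (h3.trans_eq ?_) hpos
    ring
  have h5 : s * inner ℝ n w ≤ |s| * |inner ℝ n w| := by
    rw [← abs_mul]; exact le_abs_self _
  have h6 : |s| * |inner ℝ n w| ≤ |s| * (c / 2 * ‖w‖) :=
    mul_le_mul_of_nonneg_left h4 (abs_nonneg _)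
  have h7 : |s| * (c / 2 * ‖w‖) ≤ c / 2 * h := by
    calc |s| * (c / 2 * ‖w‖) = c / 2 * (|s| * ‖w‖) := by ring
      _ ≤ _ := mul_le_mul_of_nonneg_left h2 (by linarith [T.c_pos])
  nlinarith [mul_pos T.c_pos T.h_pos]

end IsTransversal

/-- A set containing a ball of radius comparable to its diameter contains a point from which its
intersection with a sufficiently flat set is seen transversally. -/
theorem exists_isTransversal {d : ℕ} {Γ K : Set (E d)} {σ : ℝ} (hσ : 0 < σ)
    (hK : Bornology.IsBounded K) (hpos : 0 < Metric.diam K) {b : E d}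
    (hb : Metric.closedBall b (Metric.diam K / (2 * σ)) ⊆ K) {n : E d} (hn : ‖n‖ = 1)
    {x₀ : E d} (hx₀ : x₀ ∈ Γ ∩ K)
    (hflat : ∀ x ∈ Γ ∩ K, ∀ y ∈ Γ ∩ K, |inner ℝ n (x - y)| ≤ 1 / (16 * σ) * ‖x - y‖) :
    ∃ z ∈ interior K, ∃ n', IsTransversal (Γ ∩ K) z n' (1 / (8 * σ)) (Metric.diam K) := by
  set h := Metric.diam K with hh
  -- The normal is oriented so that `x₀` is on the nonnegative side of the ball's centre; moving the
  -- centre along `-m` then increases the height of every point of `Γ ∩ K`.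
  obtain ⟨m, hm, hflat', hside⟩ : ∃ m : E d, ‖m‖ = 1 ∧
      (∀ x ∈ Γ ∩ K, ∀ y ∈ Γ ∩ K, |inner ℝ m (x - y)| ≤ 1 / (16 * σ) * ‖x - y‖) ∧
      0 ≤ inner ℝ m (x₀ - b) := by
    rcases le_total 0 (inner ℝ n (x₀ - b)) with h0 | h0
    · exact ⟨n, hn, hflat, h0⟩
    · refine ⟨-n, by rwa [norm_neg], fun x hx y hy => ?_, ?_⟩
      · rw [inner_neg_left, abs_neg]; exact hflat x hx y hy
      · rw [inner_neg_left]; linarith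
  have hr : 0 < h / (4 * σ) := by positivity
  have hzb : b - (h / (4 * σ)) • m ∈ Metric.ball b (h / (2 * σ)) := by
    rw [mem_ball_iff_norm, sub_sub_cancel_left, norm_neg, norm_smul, hm, mul_one, Real.norm_eq_abs,
      abs_of_pos hr]
    gcongr
    norm_num
  have hz : b - (h / (4 * σ)) • m ∈ interior K :=
    interior_maximal (Metric.ball_subset_closedBall.trans hb) Metric.isOpen_ball hzb
  have hdist : ∀ x ∈ K, ∀ y ∈ K, ‖x - y‖ ≤ h := fun x hx y hy => by
    rw [← dist_eq_norm]; exact Metric.dist_le_diam_of_mem hK hx hy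
  refine ⟨_, hz, m, hm, by positivity, hpos, fun x hx => ?_,
    fun x hx => hdist x hx.2 _ (interior_subset hz), fun x hx y hy => ?_⟩
  · have h1 := neg_le_of_abs_le (hflat' x hx x₀ hx₀)
    have h2 : 1 / (16 * σ) * ‖x - x₀‖ ≤ 1 / (16 * σ) * h :=
      mul_le_mul_of_nonneg_left (hdist x hx.2 x₀ hx₀.2) (by positivity)
    have e1 : x - (b - (h / (4 * σ)) • m) = (x - x₀) + (x₀ - b) + (h / (4 * σ)) • m := by abel
    rw [e1, inner_add_right, inner_add_right, real_inner_smul_right, real_inner_self_eq_norm_sq, hm]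
    have e2 : h / (4 * σ) * 1 ^ 2 = 1 / (8 * σ) * h + 2 * (1 / (16 * σ) * h) := by
      field_simp; norm_num
    have e3 : 0 < 1 / (16 * σ) * h := by positivity
    rw [e2]
    linarith
  · refine (hflat' x hx y hy).trans_eq ?_
    congr 1
    field_simp; norm_num

/-! ### The part of an element on the side of the point of view is star-shaped -/

section StarShaped

variable {d : ℕ} {Ω : Set (E d)} {Ωs : Fin 2 → Set (E d)} {Γ K : Set (E d)} {z n : E d}
  {c h : ℝ} {i : Fin 2}

/-- An open convex set is the interior of its closure, so an element covered only by `closure Ω`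
still has its interior in `Ω`. -/
theorem IsInterfaceSplitting.interior_subset (S : IsInterfaceSplitting Ω Ωs Γ)
    (hK : K ⊆ closure Ω) : interior K ⊆ Ω := by
  rcases Ω.eq_empty_or_nonempty with h0 | h0
  · rw [h0, closure_empty] at hK
    exact (interior_mono hK).trans (by simp)
  · have := S.convex.interior_closure_eq_interior_of_nonempty_interior
      (S.isOpen.interior_eq.symm ▸ h0)
    rw [S.isOpen.interior_eq] at this
    exact (interior_mono hK).trans this.le

theorem lineMap_mem_interior (hKc : Convex ℝ K) (hz : z ∈ interior K) {y : E d} (hy : y ∈ K)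
    {t : ℝ} (ht : t ∈ Ico (0 : ℝ) 1) : z + t • (y - z) ∈ interior K := by
  have := hKc.combo_interior_self_mem_interior hz hy (a := 1 - t) (b := t) (by linarith [ht.2])
    ht.1 (by ring)
  convert this using 1
  rw [sub_smul, smul_sub, one_smul]; abel

theorem exists_smul_of_mem_segment {a b x : E d} (hx : x ∈ segment ℝ a b) :
    ∃ t ∈ Icc (0 : ℝ) 1, x = a + t • (b - a) := by
  rw [segment_eq_image'] at hx
  obtain ⟨t, ht, rfl⟩ := hx
  exact ⟨t, ht, rfl⟩

theorem mem_part_of_segment (S : IsInterfaceSplitting Ω Ωs Γ) (hKΩ : K ⊆ closure Ω)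
    (hKc : Convex ℝ K) (hz : z ∈ interior K) (hzi : z ∈ Ωs i) {y : E d} (hy : y ∈ interior K)
    (hΓ : ∀ t ∈ Icc (0 : ℝ) 1, z + t • (y - z) ∉ Γ) : y ∈ Ωs i := by
  refine S.subset_part (convex_segment z y).isPreconnected
    ((hKc.interior.segment_subset hz hy).trans (S.interior_subset hKΩ)) (disjoint_left.2 ?_)
    (left_mem_segment ℝ z y) hzi (right_mem_segment ℝ z y)
  intro x hx
  obtain ⟨t, ht, rfl⟩ := exists_smul_of_mem_segment hx
  exact hΓ t ht

/-- An earlier point of `Γ` on the segment would lie on the same ray as `x`, against transversality.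
-/
theorem cone_subset (S : IsInterfaceSplitting Ω Ωs Γ) (hKΩ : K ⊆ closure Ω) (hKc : Convex ℝ K)
    (T : IsTransversal (Γ ∩ K) z n c h) (hz : z ∈ interior K) (hzi : z ∈ Ωs i) {x : E d}
    (hx : x ∈ Γ ∩ K) {t : ℝ} (ht : t ∈ Ico (0 : ℝ) 1) :
    z + t • (x - z) ∈ interior K ∩ Ωs i := by
  have hin := lineMap_mem_interior hKc hz hx.2 ht
  refine ⟨hin, mem_part_of_segment S hKΩ hKc hz hzi hin fun s hs hsΓ => ?_⟩
  rw [add_sub_cancel_left, smul_smul] at hsΓ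
  have hst : s * t ∈ Ico (0 : ℝ) 1 :=
    ⟨mul_nonneg hs.1 ht.1, (mul_le_of_le_one_left ht.1 hs.2).trans_lt ht.2⟩
  have h1 : z + (1 : ℝ) • (x - z) ∈ Γ ∩ K := by rwa [one_smul, add_sub_cancel]
  have := T.eq_of_mem ⟨hsΓ, interior_subset (lineMap_mem_interior hKc hz hx.2 hst)⟩ h1
  exact hst.2.ne this

/-- A segment from `z` to `y` could meet `Γ` without changing sides. Perturbing such a point into
the other part `Ωs j` yields a ray going from `Ωs i` to `Ωs j` and back, hence crossing `Γ` twice.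
-/
theorem starShaped (S : IsInterfaceSplitting Ω Ωs Γ) (hKΩ : K ⊆ closure Ω) (hKc : Convex ℝ K)
    (T : IsTransversal (Γ ∩ K) z n c h) (hz : z ∈ interior K) (hzi : z ∈ Ωs i) {y : E d}
    (hy : y ∈ interior K ∩ Ωs i) {t : ℝ} (ht : t ∈ Icc (0 : ℝ) 1) :
    z + t • (y - z) ∈ interior K ∩ Ωs i := by
  have hseg : ∀ {a b : E d}, a ∈ interior K → b ∈ interior K → segment ℝ a b ⊆ interior K :=
    fun ha hb => hKc.interior.segment_subset ha hb
  have havoid : ∀ t ∈ Icc (0 : ℝ) 1, z + t • (y - z) ∉ Γ := by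
    intro t ht hΓ
    set x := z + t • (y - z) with hx
    have ht0 : t ≠ 0 := by
      rintro rfl
      rw [hx, zero_smul, add_zero] at hΓ
      exact S.notMem_interface hzi hΓ
    have htpos : 0 < t := lt_of_le_of_ne ht.1 (Ne.symm ht0)
    have hxK : x ∈ interior K := hseg hz hy.1 (by
      rw [segment_eq_image']; exact ⟨t, ht, rfl⟩)
    obtain ⟨j, hij⟩ := exists_ne i
    have hcont : Continuous fun q : E d => z + t⁻¹ • (q - z) := by fun_prop
    have hopen : IsOpen (interior K ∩
        (fun q : E d => z + t⁻¹ • (q - z)) ⁻¹' (interior K ∩ Ωs i)) :=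
      isOpen_interior.inter ((isOpen_interior.inter (S.isOpen_part i)).preimage hcont)
    have hxcl : x ∈ closure (Ωs j) := frontier_subset_closure (S.interface_subset_frontier j hΓ)
    -- Every point of `Γ` is a limit of points of `Ωs j`. Choose `q` there so close to `x` that its
    -- dilate by `t⁻¹` from `z` is still on the side of `y`.
    obtain ⟨q, ⟨hqK, hqy⟩, hqj⟩ := mem_closure_iff.1 hxcl _ hopen ⟨hxK, by
      rw [mem_preimage, hx, add_sub_cancel_left, smul_smul, inv_mul_cancel₀ ht0, one_smul,
        add_sub_cancel]
      exact hy⟩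
    rw [mem_preimage] at hqy
    obtain ⟨x₁, hx₁, hx₁Γ⟩ := S.exists_mem_segment hij.symm hzi hqj
      ((hseg hz hqK).trans (S.interior_subset hKΩ))
    obtain ⟨x₂, hx₂, hx₂Γ⟩ := S.exists_mem_segment hij hqj hqy.2
      ((hseg hqK hqy.1).trans (S.interior_subset hKΩ))
    have hx₁K := interior_subset (hseg hz hqK hx₁)
    have hx₂K := interior_subset (hseg hqK hqy.1 hx₂)
    obtain ⟨s₁, hs₁, e₁⟩ := exists_smul_of_mem_segment hx₁
    obtain ⟨s₂, hs₂, e₂⟩ := exists_smul_of_mem_segment hx₂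
    have e₂' : x₂ = z + (1 + s₂ * (t⁻¹ - 1)) • (q - z) := by
      rw [e₂, add_smul, one_smul, mul_smul, sub_smul, one_smul]
      rw [show z + t⁻¹ • (q - z) - q = t⁻¹ • (q - z) - (q - z) by abel]
      abel
    have ht1 : 0 ≤ t⁻¹ - 1 := sub_nonneg.2 ((one_le_inv₀ htpos).2 ht.2)
    -- The two crossings have parameters `s₁ ≤ 1` and at least `1` along `q - z`; being equal, both
    -- are `1`, so `q` itself is on `Γ`, which is impossible in `Ωs j`.
    have heq : s₁ = 1 + s₂ * (t⁻¹ - 1) :=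
      T.eq_of_mem (w := q - z) (e₁ ▸ (⟨hx₁Γ, hx₁K⟩ : x₁ ∈ Γ ∩ K))
        (e₂' ▸ (⟨hx₂Γ, hx₂K⟩ : x₂ ∈ Γ ∩ K))
    have hs1 : s₁ = 1 := le_antisymm hs₁.2 (by
      rw [heq]; linarith [mul_nonneg hs₂.1 ht1])
    rw [hs1, one_smul, add_sub_cancel] at e₁
    exact S.notMem_interface hqj (e₁ ▸ hx₁Γ)
  have hin : z + t • (y - z) ∈ interior K := hseg hz hy.1 (by
    rw [segment_eq_image']; exact ⟨t, ht, rfl⟩)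
  refine ⟨hin, mem_part_of_segment S hKΩ hKc hz hzi hin fun s hs => ?_⟩
  rw [add_sub_cancel_left, smul_smul]
  exact havoid _ ⟨mul_nonneg hs.1 ht.1, mul_le_one₀ hs.2 ht.1 ht.2⟩

/-- By continuity of dilations, points of the open segment belong to `Ωs i` unless they are on `Γ`.
If one is on `Γ`, a point farther along the ray is not, and star-shapedness seen from there gives a
contradiction. -/
theorem starShaped_closure (S : IsInterfaceSplitting Ω Ωs Γ) (hKΩ : K ⊆ closure Ω)
    (hKc : Convex ℝ K) (hKcl : IsClosed K) (T : IsTransversal (Γ ∩ K) z n c h)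
    (hz : z ∈ interior K) (hzi : z ∈ Ωs i) {y : E d} (hy : y ∈ closure (interior K ∩ Ωs i))
    {t : ℝ} (ht : t ∈ Ico (0 : ℝ) 1) : z + t • (y - z) ∈ interior K ∩ Ωs i := by
  have hyK : y ∈ K :=
    closure_minimal (inter_subset_left.trans interior_subset) hKcl hy
  have key : ∀ s ∈ Ico (0 : ℝ) 1, z + s • (y - z) ∉ Γ → z + s • (y - z) ∈ interior K ∩ Ωs i := by
    intro s hs hsΓ
    have hin := lineMap_mem_interior hKc hz hyK hs
    refine ⟨hin, S.mem_part_of_mem_closure ?_ (S.interior_subset hKΩ hin) hsΓ⟩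
    have hcont : Continuous fun q : E d => z + s • (q - z) := by fun_prop
    have hmaps : MapsTo (fun q : E d => z + s • (q - z)) (interior K ∩ Ωs i) (Ωs i) :=
      fun q hq => (starShaped S hKΩ hKc T hz hzi hq ⟨hs.1, hs.2.le⟩).2
    exact hmaps.closure hcont hy
  refine key t ht fun hΓ => ?_
  obtain ⟨s, hts, hs1⟩ := exists_between ht.2
  have hs : s ∈ Ico (0 : ℝ) 1 := ⟨ht.1.trans hts.le, hs1⟩
  have hsΓ : z + s • (y - z) ∉ Γ := fun hsΓ => hts.ne (T.eq_of_mem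
    ⟨hΓ, interior_subset (lineMap_mem_interior hKc hz hyK ht)⟩
    ⟨hsΓ, interior_subset (lineMap_mem_interior hKc hz hyK hs)⟩)
  have hspos : 0 < s := ht.1.trans_lt hts
  have := starShaped S hKΩ hKc T hz hzi (key s hs hsΓ) (t := t / s)
    ⟨div_nonneg ht.1 hspos.le, (div_le_one hspos).2 hts.le⟩
  rw [add_sub_cancel_left, smul_smul, div_mul_cancel₀ _ hspos.ne'] at this
  exact S.notMem_interface this.2 hΓ

end StarShaped

/-! ### Integration along the rays issuing from a point -/

/-- Complete `n` to an orthonormal basis and apply Fubini to split off the coordinate along `n`. -/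
theorem exists_hyperplane_coordinates {m : ℕ} {n : E (m + 1)} (hn : ‖n‖ = 1) :
    ∃ (ι : E m →ₗᵢ[ℝ] E (m + 1)) (P : E (m + 1) →L[ℝ] E m),
      (∀ x, x = (inner ℝ n x : ℝ) • n + ι (P x)) ∧
      ∀ f : E (m + 1) → ℝ≥0∞, Measurable f →
        ∫⁻ x, f x = ∫⁻ s : ℝ, ∫⁻ w : E m, f (s • n + ι w) := by
  obtain ⟨b, hb⟩ := Orthonormal.exists_orthonormalBasis_extension_of_card_eq (𝕜 := ℝ)
    (E := E (m + 1)) (ι := Fin (m + 1)) (by simp) (v := fun _ => n) (s := {0}) (by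
      constructor
      · rintro ⟨i, hi⟩; exact hn
      · rintro ⟨i, hi⟩ ⟨j, hj⟩ hij
        exact (hij (Subtype.ext (hi.trans hj.symm))).elim)
  have hb0 : b 0 = n := hb 0 rfl
  let ι₀ : E m →ₗ[ℝ] E (m + 1) :=
    { toFun := fun w => ∑ j : Fin m, w j • b j.succ
      map_add' := fun v w => by simp [add_smul, Finset.sum_add_distrib]
      map_smul' := fun r w => by simp [Finset.smul_sum, mul_smul] }
  have hι : ∀ w, ι₀ w = b.repr.symm (WithLp.toLp 2 (Fin.cons 0 (fun j => w j))) := by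
    intro w
    rw [← OrthonormalBasis.sum_repr_symm, Fin.sum_univ_succ]
    simp [ι₀]
  let P₀ : E (m + 1) →ₗ[ℝ] E m :=
    { toFun := fun x => WithLp.toLp 2 fun j : Fin m => b.repr x j.succ
      map_add' := fun v w => by ext; simp
      map_smul' := fun r w => by ext; simp }
  refine ⟨⟨ι₀, fun w => ?_⟩, LinearMap.toContinuousLinearMap P₀, fun x => ?_, fun f hf => ?_⟩
  · rw [hι, LinearIsometryEquiv.norm_map, EuclideanSpace.norm_eq, EuclideanSpace.norm_eq,
      Fin.sum_univ_succ]
    simp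
  · conv_lhs => rw [← b.sum_repr x, Fin.sum_univ_succ, b.repr_apply_apply, hb0]
    rfl
  · have h1 := b.measurePreserving_repr_symm
    have h2 := PiLp.volume_preserving_toLp (Fin (m + 1))
    have h3 := (volume_preserving_piFinSuccAbove (fun _ : Fin (m + 1) => ℝ) 0).symm
    have h5 := ((h1.comp h2).comp h3).lintegral_comp hf
    have h6 : Measurable fun p => f (((b.repr.symm ∘ WithLp.toLp 2) ∘
        (MeasurableEquiv.piFinSuccAbove (fun _ : Fin (m + 1) => ℝ) 0).symm) p) :=
      hf.comp ((h1.comp h2).comp h3).measurable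
    rw [← h5, Measure.volume_eq_prod, lintegral_prod _ h6.aemeasurable]
    refine lintegral_congr fun s => ?_
    have hm : Measurable fun w : E m => f (s • n + ι₀ w) :=
      hf.comp ((LinearMap.continuous_of_finiteDimensional ι₀).measurable.const_add _)
    have h4 := PiLp.volume_preserving_toLp (Fin m)
    change _ = ∫⁻ w : E m, f (s • n + ι₀ w)
    rw [← h4.lintegral_comp hm]
    refine lintegral_congr fun w => ?_
    simp only [Function.comp]
    congr 1
    rw [hι, ← hb0, ← OrthonormalBasis.sum_repr_symm, ← OrthonormalBasis.sum_repr_symm,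
      Fin.sum_univ_succ, Fin.sum_univ_succ]
    simp [MeasurableEquiv.piFinSuccAbove_symm_apply]

theorem lintegral_comp_smul {V : Type*} [NormedAddCommGroup V] [NormedSpace ℝ V]
    [MeasurableSpace V] [BorelSpace V] [FiniteDimensional ℝ V] (μ : Measure V)
    [μ.IsAddHaarMeasure] (f : V → ℝ≥0∞) {r : ℝ} (hr : 0 < r) :
    ENNReal.ofReal (r ^ Module.finrank ℝ V) * ∫⁻ x, f (r • x) ∂μ = ∫⁻ x, f x ∂μ := by
  have h := lintegral_map_equiv (μ := μ) f (Homeomorph.smulOfNeZero r hr.ne').toMeasurableEquiv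
  have h2 : ((Homeomorph.smulOfNeZero r hr.ne').toMeasurableEquiv : V → V) = (r • ·) := rfl
  rw [h2, Measure.map_addHaar_smul μ hr.ne', lintegral_smul_measure] at h
  change _ = ∫⁻ x, f (r • x) ∂μ at h
  rw [← h, smul_eq_mul, ← mul_assoc, ← ENNReal.ofReal_mul (by positivity),
    abs_of_pos (by positivity), mul_inv_cancel₀ (by positivity), ENNReal.ofReal_one, one_mul]

theorem lintegral_Ioo_comp_mul {m : ℕ} (g : ℝ → ℝ≥0∞) {r : ℝ} (hr : 0 < r) :
    ENNReal.ofReal (r ^ (m + 1)) * ∫⁻ t in Ioo (0 : ℝ) 1, ENNReal.ofReal (t ^ m) * g (t * r) =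
      ∫⁻ s in Ioo (0 : ℝ) r, ENNReal.ofReal (s ^ m) * g s := by
  rw [← lintegral_indicator measurableSet_Ioo, ← lintegral_indicator measurableSet_Ioo,
    ← lintegral_comp_smul volume ((Ioo 0 r).indicator fun s => ENNReal.ofReal (s ^ m) * g s) hr,
    Module.finrank_self, pow_one, pow_succ',
    ENNReal.ofReal_mul hr.le, mul_assoc, ← lintegral_const_mul' _ _ ENNReal.ofReal_ne_top]
  congr 1
  refine lintegral_congr fun t => ?_
  simp only [indicator, smul_eq_mul, mem_Ioo, mul_pos_iff_of_pos_left hr, mul_lt_iff_lt_one_right hr]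
  split_ifs with h
  · rw [← mul_assoc, ← ENNReal.ofReal_mul (by positivity), mul_pow, mul_comm t r]
  · simp

/-- Conical coordinates `x = s • (n + ι w)`: at fixed height `s` the substitution `w ↦ s • w` has
Jacobian `s ^ m`. Only the half-space `s > 0` is swept, hence an inequality. -/
theorem lintegral_rays_le {m : ℕ} {n : E (m + 1)} {ι : E m →ₗᵢ[ℝ] E (m + 1)}
    (hF : ∀ f : E (m + 1) → ℝ≥0∞, Measurable f →
        ∫⁻ x, f x = ∫⁻ s : ℝ, ∫⁻ w : E m, f (s • n + ι w))
    {g : E (m + 1) → ℝ≥0∞} (hg : Measurable g) :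
    ∫⁻ w : E m, ∫⁻ s in Ioi (0 : ℝ), ENNReal.ofReal (s ^ m) * g (s • (n + ι w)) ≤ ∫⁻ x, g x := by
  have hmeas : Measurable fun p : E m × ℝ => ENNReal.ofReal (p.2 ^ m) * g (p.2 • (n + ι p.1)) := by
    refine Measurable.mul (by fun_prop) (hg.comp ?_)
    have := ι.continuous
    fun_prop
  rw [lintegral_lintegral_swap hmeas.aemeasurable, hF g hg]
  refine (setLIntegral_mono' measurableSet_Ioi fun s hs => ?_).trans
    (setLIntegral_le_lintegral _ _)
  have := lintegral_comp_smul (volume : Measure (E m)) (fun w => g (s • n + ι w)) hs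
  rw [finrank_euclideanSpace, Fintype.card_fin] at this
  rw [← this, ← lintegral_const_mul' _ _ ENNReal.ofReal_ne_top]
  refine (lintegral_congr fun w => ?_).le
  rw [smul_add, map_smul]

/-- A Lipschitz map increases `m`-dimensional Hausdorff measure by a factor at most `L ^ m`; the
normalization is the same in source and target and cancels. -/
theorem surfaceMeasure_le_map {m : ℕ} {e : Set (E (m + 1))} {W : Set (E m)}
    {ψ : E m → E (m + 1)} {L : NNReal} (hW : MeasurableSet W) (hψ : LipschitzOnWith L ψ W)
    (he : e ⊆ ψ '' W) :
    surfaceMeasure e ≤ ((L : ℝ≥0∞) ^ m) • Measure.map ψ (volume.restrict W) := by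
  refine Measure.le_intro fun A hA _ => ?_
  have hψm : AEMeasurable ψ (volume.restrict W) := hψ.continuousOn.aemeasurable hW
  rw [Measure.smul_apply, Measure.map_apply_of_aemeasurable hψm hA, surfaceMeasure,
    Measure.restrict_apply hA, smul_eq_mul, Nat.add_sub_cancel]
  have hsub : A ∩ e ⊆ ψ '' (ψ ⁻¹' A ∩ W) := by
    rintro x ⟨hxA, hxe⟩
    obtain ⟨w, hw, rfl⟩ := he hxe
    exact ⟨w, ⟨hxA, hw⟩, rfl⟩
  refine (measure_mono hsub).trans ?_
  refine le_trans ?_ (mul_le_mul_right (Measure.le_restrict_apply _ _) _)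
  rw [← EuclideanSpace.euclideanHausdorffMeasure_eq_volume, Measure.euclideanHausdorffMeasure_def,
    Measure.euclideanHausdorffMeasure_def, Measure.smul_apply, Measure.smul_apply]
  have h := (hψ.mono (inter_subset_right (s := ψ ⁻¹' A))).hausdorffMeasure_image_le
    (Nat.cast_nonneg m)
  rw [ENNReal.rpow_natCast] at h
  rw [ENNReal.smul_def, ENNReal.smul_def, smul_eq_mul, smul_eq_mul, mul_left_comm]
  exact mul_le_mul_right h _

/-- Integrating over a transversal set along the rays from the point of view is controlled by
integration over the cone which these rays sweep. -/
theorem IsTransversal.lintegral_cone_le {m : ℕ} {e : Set (E (m + 1))} {z n : E (m + 1)} {c h : ℝ}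
    (T : IsTransversal e z n c h) (he : IsCompact e) {D : Set (E (m + 1))} (hD : MeasurableSet D)
    (hcone : ∀ x ∈ e, ∀ t ∈ Ioo (0 : ℝ) 1, z + t • (x - z) ∈ D)
    {f : E (m + 1) → ℝ≥0∞} (hf : Measurable f) :
    ∫⁻ x, ∫⁻ t in Ioo (0 : ℝ) 1, ENNReal.ofReal (t ^ m) * f (z + t • (x - z)) ∂volume
        ∂(surfaceMeasure e) ≤
      ENNReal.ofReal (2 ^ m / c ^ (m + 1) / h) * ∫⁻ y in D, f y := by
  have hc := T.c_pos
  have hh := T.h_pos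
  obtain ⟨ι, P, hP, hF⟩ := exists_hyperplane_coordinates T.norm_eq
  set a : E (m + 1) → ℝ := fun x => inner ℝ n (x - z) with ha
  have ha_ge : ∀ x ∈ e, c * h ≤ a x := T.height
  have ha_pos : ∀ x ∈ e, 0 < a x := fun x hx => (mul_pos hc hh).trans_le (ha_ge x hx)
  have ha_le : ∀ x ∈ e, a x ≤ h := fun x hx => by
    refine (real_inner_le_norm _ _).trans ?_
    rw [T.norm_eq, one_mul]; exact T.dist_le x hx
  -- Central projection from `z` onto the hyperplane at height `1` above it.
  set π : E (m + 1) → E m := fun x => (a x)⁻¹ • P (x - z) with hπ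
  have hx_eq : ∀ x ∈ e, x - z = a x • (n + ι (π x)) := fun x hx => by
    rw [hπ, map_smul, smul_add, smul_smul, mul_inv_cancel₀ (ha_pos x hx).ne', one_smul]
    exact hP (x - z)
  -- The inverse of `π` is Lipschitz: the change of height has slope at most `c / 2`, and `n + ι (π
  -- y)` has norm at most `1 / c`, so that term is at most half of `‖x - y‖` and is absorbed.
  have hanti : ∀ x ∈ e, ∀ y ∈ e, ‖x - y‖ ≤ 2 * h * ‖π x - π y‖ := by
    intro x hx y hy
    have e1 : x - y = a x • ι (π x - π y) + (a x - a y) • (n + ι (π y)) := by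
      rw [← sub_sub_sub_cancel_right x y z, hx_eq x hx, hx_eq y hy, map_sub, sub_smul, smul_sub,
        smul_add]
      simp only [smul_add]
      abel
    have e2 : a x - a y = inner ℝ n (x - y) := by
      rw [ha]; simp only; rw [← inner_sub_right, sub_sub_sub_cancel_right]
    have e3 : ‖n + ι (π y)‖ ≤ 1 / c := by
      have := T.dist_le y hy
      rw [hx_eq y hy, norm_smul, Real.norm_eq_abs, abs_of_pos (ha_pos y hy)] at this
      rw [le_div_iff₀ hc]
      have h4 := mul_le_mul_of_nonneg_right (ha_ge y hy) (norm_nonneg (n + ι (π y)))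
      nlinarith
    have e4 : ‖x - y‖ ≤ a x * ‖π x - π y‖ + |a x - a y| * ‖n + ι (π y)‖ := by
      conv_lhs => rw [e1]
      refine (norm_add_le _ _).trans_eq ?_
      rw [norm_smul, norm_smul, Real.norm_eq_abs, Real.norm_eq_abs, abs_of_pos (ha_pos x hx),
        ι.norm_map]
    have e5 : |a x - a y| * ‖n + ι (π y)‖ ≤ c / 2 * ‖x - y‖ * (1 / c) := by
      refine mul_le_mul ?_ e3 (norm_nonneg _) (by positivity)
      rw [e2]; exact T.flat x hx y hy
    have e6 : c / 2 * ‖x - y‖ * (1 / c) = ‖x - y‖ / 2 := by field_simp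
    have e7 := mul_le_mul_of_nonneg_right (ha_le x hx) (norm_nonneg (π x - π y))
    linarith
  have hinj : InjOn π e := fun x hx y hy hxy => by
    have := hanti x hx y hy
    rw [hxy, sub_self, norm_zero, mul_zero] at this
    exact sub_eq_zero.1 (norm_le_zero_iff.1 this)
  have hacont : Continuous a := by fun_prop
  have hπcont : ContinuousOn π e := by
    refine ContinuousOn.smul (hacont.continuousOn.inv₀ fun x hx => (ha_pos x hx).ne') ?_
    fun_prop
  set W := π '' e
  have hWm : MeasurableSet W := (he.image_of_continuousOn hπcont).measurableSet
  set ψ := Function.invFunOn π e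
  have hψe : ∀ w ∈ W, ψ w ∈ e := fun w hw => Function.invFunOn_mem hw
  have hπψ : ∀ w ∈ W, π (ψ w) = w := fun w hw => Function.invFunOn_eq hw
  have hψ : LipschitzOnWith (Real.toNNReal (2 * h)) ψ W := by
    refine LipschitzOnWith.of_dist_le_mul fun w hw w' hw' => ?_
    rw [dist_eq_norm, dist_eq_norm, Real.coe_toNNReal _ (by positivity)]
    have := hanti _ (hψe w hw) _ (hψe w' hw')
    rwa [hπψ w hw, hπψ w' hw'] at this
  have heW : e ⊆ ψ '' W := fun x hx =>
    ⟨π x, mem_image_of_mem _ hx, hinj (hψe _ (mem_image_of_mem _ hx)) hx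
      (hπψ _ (mem_image_of_mem _ hx))⟩
  set F : E (m + 1) → ℝ≥0∞ := fun x =>
    ∫⁻ t in Ioo (0 : ℝ) 1, ENNReal.ofReal (t ^ m) * f (z + t • (x - z))
  have hFm : Measurable F := by
    refine Measurable.lintegral_prod_right'
      (f := fun p : E (m + 1) × ℝ => ENNReal.ofReal (p.2 ^ m) * f (z + p.2 • (p.1 - z))) ?_
    exact Measurable.mul (by fun_prop) (hf.comp (by fun_prop))
  set g : E (m + 1) → ℝ≥0∞ := fun y => D.indicator f (z + y)
  have hgm : Measurable g := (hf.indicator hD).comp (by fun_prop)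
  have hFle : ∀ w ∈ W, ENNReal.ofReal ((c * h) ^ (m + 1)) * F (ψ w) ≤
      ∫⁻ s in Ioi (0 : ℝ), ENNReal.ofReal (s ^ m) * g (s • (n + ι w)) := by
    intro w hw
    have hx := hψe w hw
    have hr := ha_pos _ hx
    have hrc : (c * h) ^ (m + 1) ≤ a (ψ w) ^ (m + 1) := by
      gcongr; exact ha_ge _ hx
    calc ENNReal.ofReal ((c * h) ^ (m + 1)) * F (ψ w)
        ≤ ENNReal.ofReal (a (ψ w) ^ (m + 1)) * F (ψ w) :=
          mul_le_mul_left (ENNReal.ofReal_le_ofReal hrc) _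
      _ = ENNReal.ofReal (a (ψ w) ^ (m + 1)) * ∫⁻ t in Ioo (0 : ℝ) 1,
            ENNReal.ofReal (t ^ m) * g ((t * a (ψ w)) • (n + ι w)) := by
          congr 1
          refine setLIntegral_congr_fun measurableSet_Ioo fun t ht => ?_
          have e1 : (t * a (ψ w)) • (n + ι w) = t • (ψ w - z) := by
            rw [mul_smul, hx_eq _ hx, hπψ w hw]
          simp only [g, e1, indicator_of_mem (hcone _ hx t ht)]
      _ = ∫⁻ s in Ioo (0 : ℝ) (a (ψ w)), ENNReal.ofReal (s ^ m) * g (s • (n + ι w)) :=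
          lintegral_Ioo_comp_mul (fun s => g (s • (n + ι w))) hr
      _ ≤ _ := lintegral_mono_set Ioo_subset_Ioi_self
  have hmain : ENNReal.ofReal ((c * h) ^ (m + 1)) * ∫⁻ w in W, F (ψ w) ≤ ∫⁻ y in D, f y := by
    rw [← lintegral_const_mul' _ _ ENNReal.ofReal_ne_top]
    calc _ ≤ ∫⁻ w in W, ∫⁻ s in Ioi (0 : ℝ), ENNReal.ofReal (s ^ m) * g (s • (n + ι w)) :=
          setLIntegral_mono' hWm hFle
      _ ≤ _ := setLIntegral_le_lintegral _ _
      _ ≤ ∫⁻ y, g y := lintegral_rays_le hF hgm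
      _ = ∫⁻ y, D.indicator f y := lintegral_add_left_eq_self (μ := volume) (D.indicator f) z
      _ = _ := lintegral_indicator hD _
  have hsurf : ∫⁻ x, F x ∂(surfaceMeasure e) ≤
      ENNReal.ofReal ((2 * h) ^ m) * ∫⁻ w in W, F (ψ w) := by
    refine (lintegral_mono' (surfaceMeasure_le_map hWm hψ heW) le_rfl).trans_eq ?_
    rw [lintegral_smul_measure, lintegral_map' hFm.aemeasurable
      (hψ.continuousOn.aemeasurable hWm), smul_eq_mul, ENNReal.ofReal_pow (by positivity)]
    rfl
  refine hsurf.trans ?_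
  -- The Lipschitz factor `(2 * h) ^ m` against the smallest possible ray scaling `(c * h) ^ (m +
  -- 1)` leaves the single factor `1 / h`.
  have e8 : (2 * h) ^ m = 2 ^ m / c ^ (m + 1) / h * (c * h) ^ (m + 1) := by
    rw [mul_pow, mul_pow, pow_succ h]; field_simp
  rw [e8, ENNReal.ofReal_mul (by positivity), mul_assoc]
  exact mul_le_mul_right hmain _

/-! ### Auxiliary identities for `L²` norms and gradients -/

theorem sq_eLpNorm_two {α F : Type*} [MeasurableSpace α] [NormedAddCommGroup F] (f : α → F)
    (μ : Measure α) : eLpNorm f 2 μ ^ 2 = ∫⁻ x, ‖f x‖ₑ ^ 2 ∂μ := by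
  have := eLpNorm_nnreal_pow_eq_lintegral (f := f) (μ := μ) (p := 2) (by norm_num)
  simpa using this

theorem lintegral_enorm_mul_le {α F G : Type*} [MeasurableSpace α] [NormedAddCommGroup F]
    [NormedAddCommGroup G] {f : α → F} {g : α → G} {μ : Measure α}
    (hf : AEMeasurable (fun x => ‖f x‖ₑ) μ) (hg : AEMeasurable (fun x => ‖g x‖ₑ) μ) :
    ∫⁻ x, ‖f x‖ₑ * ‖g x‖ₑ ∂μ ≤ eLpNorm f 2 μ * eLpNorm g 2 μ := by
  have h := ENNReal.lintegral_mul_le_Lp_mul_Lq μ Real.HolderConjugate.two_two hf hg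
  rw [eLpNorm_eq_lintegral_rpow_enorm_toReal two_ne_zero ENNReal.ofNat_ne_top,
    eLpNorm_eq_lintegral_rpow_enorm_toReal two_ne_zero ENNReal.ofNat_ne_top]
  simpa using h

theorem le_of_sq_le_sq_ennreal {x y : ℝ≥0∞} (h : x ^ 2 ≤ y ^ 2) : x ≤ y :=
  (ENNReal.pow_le_pow_left_iff two_ne_zero).1 h

theorem enorm_sq_eq_ofReal (r : ℝ) : ‖r‖ₑ ^ 2 = ENNReal.ofReal (r ^ 2) := by
  rw [← ofReal_norm, ← ENNReal.ofReal_pow (norm_nonneg _), Real.norm_eq_abs, sq_abs]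

theorem norm_gradient {d : ℕ} (u : E d → ℝ) (x : E d) : ‖∇ u x‖ = ‖fderiv ℝ u x‖ :=
  LinearIsometryEquiv.norm_map _ _

theorem enorm_gradient {d : ℕ} (u : E d → ℝ) (x : E d) : ‖∇ u x‖ₑ = ‖fderiv ℝ u x‖ₑ := by
  rw [← ofReal_norm, norm_gradient, ofReal_norm]

theorem continuous_gradient {d : ℕ} {u : E d → ℝ} (hu : ContDiff ℝ 1 u) : Continuous (∇ u) :=
  (LinearIsometryEquiv.continuous _).comp (hu.continuous_fderiv (by norm_num))

/-! ### The trace inequality for smooth functions -/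

/-- Integrate the derivative of `t ^ (m + 1) * u ^ 2` along the ray. The power removes the boundary
term at `z` and leaves exactly the factor `t ^ m`, the density of the cone. -/
theorem sq_le_integral_ray {d m : ℕ} {u : E d → ℝ} (hu : ContDiff ℝ 1 u) (x z : E d) {h : ℝ}
    (hxz : ‖x - z‖ ≤ h) :
    u x ^ 2 ≤ ∫ t in (0 : ℝ)..1, t ^ m * ((m + 1) * u (z + t • (x - z)) ^ 2 +
      2 * h * (|u (z + t • (x - z))| * ‖fderiv ℝ u (z + t • (x - z))‖)) := by
  have hfc := hu.continuous_fderiv (by norm_num)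
  have huc := hu.continuous
  have hγ : ∀ t : ℝ, HasDerivAt (fun t : ℝ => z + t • (x - z)) (x - z) t := fun t => by
    simpa using ((hasDerivAt_id t).smul_const (x - z)).const_add z
  have hγc : Continuous fun t : ℝ => z + t • (x - z) := by fun_prop
  have huγ : ∀ t : ℝ, HasDerivAt (fun t : ℝ => u (z + t • (x - z)))
      (fderiv ℝ u (z + t • (x - z)) (x - z)) t := fun t =>
    ((hu.differentiable (by norm_num)) _).hasFDerivAt.comp_hasDerivAt t (hγ t)
  have hder : ∀ t : ℝ, HasDerivAt (fun t : ℝ => t ^ (m + 1) * u (z + t • (x - z)) ^ 2)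
      (t ^ m * ((m + 1) * u (z + t • (x - z)) ^ 2 +
        t * (2 * (u (z + t • (x - z)) * fderiv ℝ u (z + t • (x - z)) (x - z))))) t := fun t => by
    refine ((hasDerivAt_pow (m + 1) t).mul ((huγ t).pow 2)).congr_deriv ?_
    simp only [Nat.add_sub_cancel, Pi.pow_apply]
    push_cast
    ring
  have hFTC := intervalIntegral.integral_eq_sub_of_hasDerivAt (a := 0) (b := 1)
    (fun t _ => hder t) ((by fun_prop : Continuous fun t => _).intervalIntegrable _ _)
  rw [one_pow, one_mul, one_smul, add_sub_cancel, zero_pow (Nat.succ_ne_zero m), zero_mul,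
    sub_zero] at hFTC
  rw [← hFTC]
  refine intervalIntegral.integral_mono_on zero_le_one
    ((by fun_prop : Continuous fun t => _).intervalIntegrable _ _)
    ((by fun_prop : Continuous fun t => _).intervalIntegrable _ _) fun t ht => ?_
  refine mul_le_mul_of_nonneg_left (add_le_add le_rfl ?_) (pow_nonneg ht.1 _)
  set a := u (z + t • (x - z))
  set L := fderiv ℝ u (z + t • (x - z))
  have h1 : a * L (x - z) ≤ |a| * (‖L‖ * h) := by
    refine (le_abs_self _).trans ?_
    rw [abs_mul]
    refine mul_le_mul_of_nonneg_left ?_ (abs_nonneg _)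
    exact (L.le_opNorm _).trans (mul_le_mul_of_nonneg_left hxz (norm_nonneg _))
  have h0 : 0 ≤ |a| * (‖L‖ * h) := mul_nonneg (abs_nonneg _)
    (mul_nonneg (norm_nonneg _) ((norm_nonneg _).trans hxz))
  calc t * (2 * (a * L (x - z))) ≤ t * (2 * (|a| * (‖L‖ * h))) := by
        have := ht.1; gcongr
    _ ≤ 1 * (2 * (|a| * (‖L‖ * h))) := by
        have := ht.2; gcongr
    _ = _ := by ring

theorem sq_enorm_le_lintegral_ray {d m : ℕ} {u : E d → ℝ} (hu : ContDiff ℝ 1 u) (x z : E d)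
    {h : ℝ} (hxz : ‖x - z‖ ≤ h) :
    ‖u x‖ₑ ^ 2 ≤ ∫⁻ t in Ioo (0 : ℝ) 1, ENNReal.ofReal (t ^ m) *
      (ENNReal.ofReal (m + 1) * ‖u (z + t • (x - z))‖ₑ ^ 2 +
      ENNReal.ofReal (2 * h) * (‖u (z + t • (x - z))‖ₑ * ‖∇ u (z + t • (x - z))‖ₑ)) := by
  have hh : 0 ≤ h := (norm_nonneg _).trans hxz
  have hfc := hu.continuous_fderiv (by norm_num)
  have huc := hu.continuous
  rw [enorm_sq_eq_ofReal]
  refine (ENNReal.ofReal_le_ofReal (sq_le_integral_ray (m := m) hu x z hxz)).trans ?_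
  rw [intervalIntegral.integral_of_le zero_le_one, integral_Ioc_eq_integral_Ioo,
    ofReal_integral_eq_lintegral_ofReal
    ((by fun_prop : Continuous fun t => _).integrableOn_Icc.mono_set Ioo_subset_Icc_self)
    (ae_restrict_of_forall_mem measurableSet_Ioo fun t ht => by
      have := ht.1.le
      positivity)]
  refine (setLIntegral_congr_fun measurableSet_Ioo fun t ht => ?_).le
  have := ht.1.le
  rw [ENNReal.ofReal_mul (by positivity), ENNReal.ofReal_add (by positivity) (by positivity),
    ENNReal.ofReal_mul (by positivity), ENNReal.ofReal_mul (by positivity),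
    ENNReal.ofReal_mul (by positivity), ENNReal.ofReal_mul (abs_nonneg _), enorm_sq_eq_ofReal,
    enorm_gradient,
    ← ofReal_norm, ← ofReal_norm, Real.norm_eq_abs]

namespace IsTransversal

variable {m : ℕ} {e D : Set (E (m + 1))} {z n : E (m + 1)} {c h : ℝ}

theorem eLpNorm_sq_le (T : IsTransversal e z n c h) (he : IsCompact e) (hD : MeasurableSet D)
    (hcone : ∀ x ∈ e, ∀ t ∈ Ioo (0 : ℝ) 1, z + t • (x - z) ∈ D)
    {u : E (m + 1) → ℝ} (hu : ContDiff ℝ 1 u) :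
    eLpNorm u 2 (surfaceMeasure e) ^ 2 ≤ ENNReal.ofReal (2 ^ m / c ^ (m + 1) / h) *
      (ENNReal.ofReal (m + 1) * eLpNorm u 2 (volume.restrict D) ^ 2 + ENNReal.ofReal (2 * h) *
        (eLpNorm u 2 (volume.restrict D) * eLpNorm (∇ u) 2 (volume.restrict D))) := by
  have hum : Measurable fun x => ‖u x‖ₑ := hu.continuous.enorm.measurable
  have hgm : Measurable fun x => ‖∇ u x‖ₑ := (continuous_gradient hu).enorm.measurable
  rw [sq_eLpNorm_two]
  have h1 : ∫⁻ x, ‖u x‖ₑ ^ 2 ∂(surfaceMeasure e) ≤ _ :=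
    setLIntegral_mono' he.measurableSet fun x hx =>
      sq_enorm_le_lintegral_ray (m := m) hu x z (T.dist_le x hx)
  refine h1.trans <| (T.lintegral_cone_le he hD hcone (f := fun y => ENNReal.ofReal (m + 1) *
    ‖u y‖ₑ ^ 2 + ENNReal.ofReal (2 * h) * (‖u y‖ₑ * ‖∇ u y‖ₑ)) (by fun_prop)).trans ?_
  refine mul_le_mul_right ?_ _
  rw [lintegral_add_left (by fun_prop), lintegral_const_mul' _ _ ENNReal.ofReal_ne_top,
    lintegral_const_mul' _ _ ENNReal.ofReal_ne_top, sq_eLpNorm_two]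
  gcongr
  exact lintegral_enorm_mul_le hum.aemeasurable hgm.aemeasurable

theorem eLpNorm_le (T : IsTransversal e z n c h) (he : IsCompact e) (hD : MeasurableSet D)
    (hcone : ∀ x ∈ e, ∀ t ∈ Ioo (0 : ℝ) 1, z + t • (x - z) ∈ D)
    {u : E (m + 1) → ℝ} (hu : ContDiff ℝ 1 u) {C : ℝ} (hC : 0 ≤ C)
    (hCA : 2 * (m + 1) * (2 ^ m / c ^ (m + 1)) ≤ C ^ 2) :
    eLpNorm u 2 (surfaceMeasure e) ≤ ENNReal.ofReal C *
      (ENNReal.ofReal (h ^ (-(1 / 2) : ℝ)) * eLpNorm u 2 (volume.restrict D) +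
        eLpNorm u 2 (volume.restrict D) ^ (1 / 2 : ℝ) *
          eLpNorm (∇ u) 2 (volume.restrict D) ^ (1 / 2 : ℝ)) := by
  have hh := T.h_pos
  have hc := T.c_pos
  refine le_of_sq_le_sq_ennreal ((T.eLpNorm_sq_le he hD hcone hu).trans ?_)
  set a := eLpNorm u 2 (volume.restrict D)
  set b := eLpNorm (∇ u) 2 (volume.restrict D)
  set A : ℝ := 2 ^ m / c ^ (m + 1) with hA
  have hApos : 0 < A := by positivity
  have hsq : ∀ y : ℝ≥0∞, (y ^ (1 / 2 : ℝ)) ^ 2 = y := fun y => by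
    rw [← ENNReal.rpow_natCast, ← ENNReal.rpow_mul]; norm_num
  have hh2 : (h ^ (-(1 / 2) : ℝ)) ^ 2 = h⁻¹ := by
    rw [← Real.rpow_natCast, ← Real.rpow_mul hh.le]; norm_num
    exact Real.rpow_neg_one h
  have hm0 : (0 : ℝ) ≤ m := by positivity
  have hα : A / h * (m + 1) ≤ C ^ 2 * h⁻¹ := by
    rw [div_mul_eq_mul_div, div_eq_mul_inv]
    gcongr
    nlinarith
  have hβ : A / h * (2 * h) ≤ C ^ 2 := by
    rw [show A / h * (2 * h) = 2 * A by field_simp]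
    nlinarith
  -- Allows the square root of a sum to be bounded by the sum of the square roots, which gives the
  -- two-term form of the estimate.
  have hadd : ∀ p q : ℝ≥0∞, p ^ 2 + q ^ 2 ≤ (p + q) ^ 2 := fun p q => by
    rw [add_sq]
    gcongr
    exact le_self_add
  calc _ = ENNReal.ofReal (A / h * (m + 1)) * a ^ 2 + ENNReal.ofReal (A / h * (2 * h)) * (a * b) := by
        rw [mul_add, ← mul_assoc, ← mul_assoc, ← ENNReal.ofReal_mul (by positivity),
          ← ENNReal.ofReal_mul (by positivity)]
    _ ≤ ENNReal.ofReal (C ^ 2 * h⁻¹) * a ^ 2 + ENNReal.ofReal (C ^ 2) * (a * b) := by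
        gcongr
    _ = ENNReal.ofReal C ^ 2 * ((ENNReal.ofReal (h ^ (-(1 / 2) : ℝ)) * a) ^ 2 +
          (a ^ (1 / 2 : ℝ) * b ^ (1 / 2 : ℝ)) ^ 2) := by
        rw [mul_pow, mul_pow, hsq, hsq, ← ENNReal.ofReal_pow hC,
          ← ENNReal.ofReal_pow (by positivity), hh2, ENNReal.ofReal_mul (by positivity)]
        ring
    _ ≤ _ := by
        rw [mul_pow (ENNReal.ofReal C)]
        exact mul_le_mul_right (hadd _ _) _

end IsTransversal

/-! ### The inverse trace inequality for polynomials -/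

section LocalPolynomials

theorem eval_aeval_line {d : ℕ} (q : MvPolynomial (Fin d) ℝ) (a b : Fin d → ℝ) (t : ℝ) :
    (MvPolynomial.aeval (fun i => Polynomial.C (a i) + Polynomial.C (b i) * Polynomial.X) q).eval t
      = MvPolynomial.eval (fun i => a i + t * b i) q := by
  rw [← Polynomial.coe_evalRingHom, MvPolynomial.aeval_def, MvPolynomial.hom_eval₂,
    MvPolynomial.eval, MvPolynomial.coe_eval₂Hom]
  congr 1
  · exact RingHom.ext fun r => Polynomial.eval_C
  · funext i
    change Polynomial.eval t (Polynomial.C (a i) + Polynomial.C (b i) * Polynomial.X) = _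
    rw [Polynomial.eval_add, Polynomial.eval_mul, Polynomial.eval_C, Polynomial.eval_C,
      Polynomial.eval_X, mul_comm]

theorem exists_polynomial_line {d N : ℕ} {q : MvPolynomial (Fin d) ℝ} (hq : q.totalDegree ≤ N)
    (a b : Fin d → ℝ) : ∃ Q : Polynomial ℝ, Q.natDegree ≤ N ∧
      ∀ t, Q.eval t = MvPolynomial.eval (fun i => a i + t * b i) q := by
  refine ⟨_, ?_, eval_aeval_line q a b⟩
  refine (MvPolynomial.aeval_natDegree_le (n := 1) q hq _ fun i => ?_).trans (by simp)
  compute_degree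

theorem totalDegree_le_mul {d p : ℕ} {q : MvPolynomial (Fin d) ℝ} (hq : ∀ i, q.degreeOf i ≤ p) :
    q.totalDegree ≤ d * p := by
  refine Finset.sup_le fun s hs => ?_
  rw [Finsupp.sum_fintype _ _ (fun _ => rfl)]
  calc ∑ i, s i ≤ ∑ _i : Fin d, p :=
        Finset.sum_le_sum fun i _ => (MvPolynomial.monomial_le_degreeOf i hs).trans (hq i)
    _ = d * p := by simp

/-- The coordinates along the edges are affine functions of the point, so lines stay lines in these
coordinates. -/
theorem exists_eq_add_sum {d : ℕ} {b : Fin d → E d} (hb : LinearIndependent ℝ b) (x₀ : E d) :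
    ∃ τ : E d → Fin d → ℝ, Continuous τ ∧ (∀ x, x₀ + ∑ i, τ x i • b i = x) ∧
      ∀ x y : E d, ∀ t : ℝ, ∀ i, τ (x + t • y) i = τ x i + t * (τ (x + y) i - τ x i) := by
  let B := basisOfLinearIndependentOfCardEqFinrank' b hb (by simp)
  refine ⟨fun x => B.equivFun (x - x₀), ?_, fun x => ?_, fun x y t i => ?_⟩
  · exact (LinearMap.continuous_of_finiteDimensional B.equivFun.toLinearMap).comp (by fun_prop)
  · have := B.sum_equivFun (x - x₀)
    simp only [B, coe_basisOfLinearIndependentOfCardEqFinrank'] at this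
    rw [this, add_sub_cancel]
  · simp only [map_sub, map_add, map_smul, Pi.sub_apply, Pi.add_apply, Pi.smul_apply, smul_eq_mul]
    ring

theorem IsLocalPolynomial.continuous {d p : ℕ} {K : Set (E d)} {v : E d → ℝ}
    (hv : IsLocalPolynomial K p v) : Continuous v := by
  have hcart : ∀ q : MvPolynomial (Fin d) ℝ,
      Continuous fun x : E d => MvPolynomial.eval (fun i => x i) q := fun q =>
    (MvPolynomial.continuous_eval q).comp (by fun_prop)
  cases hv with
  | simplex hK q hq hv => exact (funext hv : v = _) ▸ hcart q
  | cartesian hK q hq hv => exact (funext hv : v = _) ▸ hcart q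
  | edge x₀ b hK q hq hv =>
    obtain ⟨τ, hτ, hτx, -⟩ := exists_eq_add_sum hK.1 x₀
    have : v = fun x => MvPolynomial.eval (τ x) q := funext fun x => by rw [← hv, hτx]
    rw [this]
    exact (MvPolynomial.continuous_eval q).comp hτ

/-- Degree at most `p` in each variable gives total degree at most `d * p`, which bounds the degree
on every line in either choice of coordinates. -/
theorem IsLocalPolynomial.exists_polynomial {d p : ℕ} {K : Set (E d)} {v : E d → ℝ} (hd : d ≠ 0)
    (hv : IsLocalPolynomial K p v) (x y : E d) :
    ∃ Q : Polynomial ℝ, Q.natDegree ≤ d * p ∧ ∀ t, Q.eval t = v (x + t • y) := by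
  have hp : p ≤ d * p := Nat.le_mul_of_pos_left _ (Nat.pos_of_ne_zero hd)
  cases hv with
  | simplex hK q hq hv =>
    obtain ⟨Q, hQ, h⟩ := exists_polynomial_line (hq.trans hp) (fun i => x i) (fun i => y i)
    exact ⟨Q, hQ, fun t => by rw [h, hv]; simp⟩
  | cartesian hK q hq hv =>
    obtain ⟨Q, hQ, h⟩ := exists_polynomial_line (totalDegree_le_mul hq) (fun i => x i)
      (fun i => y i)
    exact ⟨Q, hQ, fun t => by rw [h, hv]; simp⟩
  | edge x₀ b hK q hq hv =>
    obtain ⟨τ, hτ, hτx, hτl⟩ := exists_eq_add_sum hK.1 x₀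
    obtain ⟨Q, hQ, h⟩ := exists_polynomial_line (totalDegree_le_mul hq) (τ x)
      (fun i => τ (x + y) i - τ x i)
    refine ⟨Q, hQ, fun t => ?_⟩
    rw [h, ← hτx (x + t • y), hv]
    congr 2
    ext i
    rw [hτl]

end LocalPolynomials

theorem IsTransversal.eLpNorm_polynomial_le {m : ℕ} {e D K : Set (E (m + 1))}
    {z n : E (m + 1)} {c h : ℝ} (T : IsTransversal e z n c h) (he : IsCompact e)
    (hD : MeasurableSet D) (hcone : ∀ x ∈ e, ∀ t ∈ Ioo (0 : ℝ) 1, z + t • (x - z) ∈ D)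
    (hm : m ≤ 2) {p : ℕ} (hp : 1 ≤ p) {v : E (m + 1) → ℝ} (hv : IsLocalPolynomial K p v)
    {C : ℝ} (hC : 0 ≤ C) (hCA : 25 * (2 ^ m / c ^ (m + 1)) ≤ C ^ 2) :
    eLpNorm v 2 (surfaceMeasure e) ≤
      ENNReal.ofReal (C * (p / h ^ (1 / 2 : ℝ))) * eLpNorm v 2 (volume.restrict D) := by
  have hh := T.h_pos
  have hc := T.c_pos
  refine le_of_sq_le_sq_ennreal ?_
  have hvm : Measurable fun x => ‖v x‖ₑ ^ 2 := (hv.continuous.enorm.measurable).pow_const 2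
  set N : ℕ := (m + 1) * p with hN
  have h1 : ∀ x, ‖v x‖ₑ ^ 2 ≤ ENNReal.ofReal (((N : ℝ) + 2) ^ 2) * ∫⁻ t in Ioo (0 : ℝ) 1,
      ENNReal.ofReal (t ^ m) * ‖v (z + t • (x - z))‖ₑ ^ 2 := fun x => by
    obtain ⟨Q, hQ, h⟩ := hv.exists_polynomial (Nat.succ_ne_zero m) z (x - z)
    have := ofReal_sq_eval_one_le hm hQ
    simp only [h, one_smul, add_sub_cancel] at this
    simp only [enorm_sq_eq_ofReal]
    exact this
  have h2 : ((N : ℝ) + 2) ^ 2 * (2 ^ m / c ^ (m + 1) / h) ≤ (C * (p / h ^ (1 / 2 : ℝ))) ^ 2 := by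
    have e1 : (h ^ (1 / 2 : ℝ)) ^ 2 = h := by
      rw [← Real.rpow_natCast, ← Real.rpow_mul hh.le]; norm_num
    have hp' : (1 : ℝ) ≤ p := by exact_mod_cast hp
    have hm' : (m : ℝ) ≤ 2 := by exact_mod_cast hm
    -- As `m ≤ 2` and `p ≥ 1`, `(m + 1) * p + 2 ≤ 3 * p + 2 ≤ 5 * p`; this is the source of the
    -- factor `25`.
    have e2 : (N : ℝ) + 2 ≤ 5 * p := by
      rw [hN]; push_cast; nlinarith
    calc _ ≤ (5 * (p : ℝ)) ^ 2 * (2 ^ m / c ^ (m + 1) / h) := by gcongr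
      _ = 25 * (2 ^ m / c ^ (m + 1)) * ((p : ℝ) ^ 2 / h) := by ring
      _ ≤ C ^ 2 * ((p : ℝ) ^ 2 / h) := by gcongr
      _ = _ := by rw [mul_pow, div_pow, e1]
  rw [mul_pow, sq_eLpNorm_two, sq_eLpNorm_two, ← ENNReal.ofReal_pow (by positivity)]
  calc ∫⁻ x, ‖v x‖ₑ ^ 2 ∂(surfaceMeasure e)
      ≤ ENNReal.ofReal (((N : ℝ) + 2) ^ 2) * ∫⁻ x, ∫⁻ t in Ioo (0 : ℝ) 1,
        ENNReal.ofReal (t ^ m) * ‖v (z + t • (x - z))‖ₑ ^ 2 ∂volume ∂(surfaceMeasure e) := by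
        rw [← lintegral_const_mul' _ _ ENNReal.ofReal_ne_top]
        exact lintegral_mono h1
    _ ≤ ENNReal.ofReal (((N : ℝ) + 2) ^ 2) * (ENNReal.ofReal (2 ^ m / c ^ (m + 1) / h) *
          ∫⁻ y in D, ‖v y‖ₑ ^ 2) :=
        mul_le_mul_right (T.lintegral_cone_le he hD hcone hvm) _
    _ ≤ _ := by
        rw [← mul_assoc, ← ENNReal.ofReal_mul (by positivity)]
        gcongr

theorem exists_pos_mul_ofReal_le {V ε : ℝ≥0∞} (hV : V ≠ ⊤) (hε : ε ≠ 0) :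
    ∃ κ : ℝ, 0 < κ ∧ V * ENNReal.ofReal κ ≤ ε := by
  have h3 : ε / (V + 1) ≠ 0 :=
    (ENNReal.div_pos hε (ENNReal.add_ne_top.2 ⟨hV, by norm_num⟩)).ne'
  obtain ⟨κ, hκ0, hκ⟩ := ENNReal.lt_iff_exists_nnreal_btwn.1 (pos_iff_ne_zero.2 h3)
  refine ⟨κ, by exact_mod_cast hκ0, ?_⟩
  rw [ENNReal.ofReal_coe_nnreal]
  calc V * κ ≤ (V + 1) * (ε / (V + 1)) := by gcongr; exact le_self_add
    _ ≤ _ := ENNReal.mul_div_le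

/-! ### Averages of dilations in `L²` -/

section Averages

variable {d : ℕ} {F : Type*} [NormedAddCommGroup F]

theorem lintegral_dilation_le {g : E d → ℝ≥0∞} (z s : E d) {r : ℝ} (hr : 1 / 2 ≤ r) :
    ∫⁻ y, g (z + r • (y - z) - s) ≤ ENNReal.ofReal (2 ^ d) * ∫⁻ y, g y := by
  have hr0 : 0 < r := by linarith
  have h1 : ∫⁻ y, g (z + r • (y - z) - s) = ∫⁻ y, g (z + r • y - s) :=
    lintegral_sub_right_eq_self (μ := volume) (fun y => g (z + r • y - s)) z
  have h2 : ∫⁻ y, g (z + y - s) = ∫⁻ y, g y := by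
    simp_rw [add_sub_right_comm]
    exact lintegral_add_left_eq_self (μ := volume) g (z - s)
  have h3 := lintegral_comp_smul volume (fun y : E d => g (z + y - s)) hr0
  rw [h2, finrank_euclideanSpace, Fintype.card_fin] at h3
  rw [h1, ← h3, ← mul_assoc, ← ENNReal.ofReal_mul (by positivity), ← mul_pow]
  refine le_mul_of_one_le_left zero_le ?_
  rw [ENNReal.one_le_ofReal]
  exact one_le_pow₀ (by linarith)

theorem lintegral_lintegral_dilation_le {f : E d → F} (hf : StronglyMeasurable f)
    (ν : Measure (E d)) [IsProbabilityMeasure ν] (z : E d) {r : ℝ} (hr : 1 / 2 ≤ r) :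
    ∫⁻ y, ∫⁻ s, ‖f (z + r • (y - z) - s)‖ₑ ^ 2 ∂ν ≤
      ENNReal.ofReal (2 ^ d) * eLpNorm f 2 volume ^ 2 := by
  rw [lintegral_lintegral_swap]
  · calc _ ≤ ∫⁻ _s, ENNReal.ofReal (2 ^ d) * eLpNorm f 2 volume ^ 2 ∂ν := by
          refine lintegral_mono fun s => ?_
          rw [sq_eLpNorm_two]
          exact lintegral_dilation_le (g := fun y => ‖f y‖ₑ ^ 2) z s hr
      _ = _ := by simp
  · refine Measurable.aemeasurable ?_
    exact (hf.enorm.comp (by fun_prop : Measurable fun p : E d × E d =>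
      z + r • (p.1 - z) - p.2)).pow_const 2

/-- By Tonelli the averaged integrals of the square are finite almost everywhere; this justifies
splitting the average of a difference. -/
theorem ae_integrable_dilation {f : E d → F} (hf : StronglyMeasurable f)
    (hf2 : MemLp f 2 volume) (ν : Measure (E d)) [IsProbabilityMeasure ν] (z : E d) {r : ℝ}
    (hr : 1 / 2 ≤ r) : ∀ᵐ y, Integrable (fun s => f (z + r • (y - z) - s)) ν := by
  have hfin : ∫⁻ y, ∫⁻ s, ‖f (z + r • (y - z) - s)‖ₑ ^ 2 ∂ν ≠ ⊤ :=
    ne_top_of_le_ne_top (ENNReal.mul_ne_top ENNReal.ofReal_ne_top (ENNReal.pow_ne_top hf2.2.ne))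
      (lintegral_lintegral_dilation_le hf ν z hr)
  have hmeas : Measurable fun y => ∫⁻ s, ‖f (z + r • (y - z) - s)‖ₑ ^ 2 ∂ν := by
    refine Measurable.lintegral_prod_right'
      (f := fun p : E d × E d => ‖f (z + r • (p.1 - z) - p.2)‖ₑ ^ 2) ?_
    exact (hf.enorm.comp (by fun_prop : Measurable fun p : E d × E d =>
      z + r • (p.1 - z) - p.2)).pow_const 2
  filter_upwards [ae_lt_top hmeas hfin] with y hy
  have hsm : StronglyMeasurable fun s => f (z + r • (y - z) - s) :=
    hf.comp_measurable (by fun_prop)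
  have : MemLp (fun s => f (z + r • (y - z) - s)) 2 ν := by
    refine ⟨hsm.aestronglyMeasurable, ?_⟩
    rw [← sq_eLpNorm_two] at hy
    by_contra hcon
    rw [not_lt, top_le_iff] at hcon
    rw [hcon] at hy
    simp at hy
  exact this.integrable (by norm_num)

variable [NormedSpace ℝ F]

/-- Averages, over small translations, of a dilation of `f` with center `z`. -/
noncomputable def dilatedAverage (z : E d) (r : ℝ) (ν : Measure (E d)) (f : E d → F) (y : E d) : F :=
  ∫ s, f (z + r • (y - z) - s) ∂ν

theorem stronglyMeasurable_dilatedAverage {f : E d → F} (hf : StronglyMeasurable f)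
    (ν : Measure (E d)) [IsProbabilityMeasure ν] (z : E d) (r : ℝ) :
    StronglyMeasurable (dilatedAverage z r ν f) := by
  refine StronglyMeasurable.integral_prod_right
    (f := fun (y s : E d) => f (z + r • (y - z) - s)) ?_
  exact hf.comp_measurable (by fun_prop : Measurable fun p : E d × E d =>
      z + r • (p.1 - z) - p.2)

theorem sq_enorm_integral_le (ν : Measure (E d)) [IsProbabilityMeasure ν] {f : E d → F}
    (hf : StronglyMeasurable f) : ‖∫ s, f s ∂ν‖ₑ ^ 2 ≤ ∫⁻ s, ‖f s‖ₑ ^ 2 ∂ν := by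
  rw [← sq_eLpNorm_two]
  refine ENNReal.pow_le_pow_left ((enorm_integral_le_lintegral_enorm f).trans ?_)
  rw [← eLpNorm_one_eq_lintegral_enorm]
  exact eLpNorm_le_eLpNorm_of_exponent_le (by norm_num) hf.aestronglyMeasurable

/-- Jensen's inequality, then a change of variables; `r ≥ 1 / 2` keeps the Jacobian `r⁻¹ ^ d` below
`2 ^ d`, uniformly in `r`. -/
theorem eLpNorm_dilatedAverage_le {f : E d → F} (hf : StronglyMeasurable f)
    (ν : Measure (E d)) [IsProbabilityMeasure ν] (z : E d) {r : ℝ} (hr : 1 / 2 ≤ r) :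
    eLpNorm (dilatedAverage z r ν f) 2 volume ≤ ENNReal.ofReal (2 ^ d) * eLpNorm f 2 volume := by
  refine le_of_sq_le_sq_ennreal ?_
  rw [sq_eLpNorm_two, mul_pow]
  have h1 : ∫⁻ y, ‖dilatedAverage z r ν f y‖ₑ ^ 2 ≤
      ∫⁻ y, ∫⁻ s, ‖f (z + r • (y - z) - s)‖ₑ ^ 2 ∂ν := lintegral_mono fun y =>
    sq_enorm_integral_le ν (hf.comp_measurable (by fun_prop))
  refine (h1.trans (lintegral_lintegral_dilation_le hf ν z hr)).trans ?_
  gcongr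
  refine le_self_pow₀ ?_ two_ne_zero
  rw [ENNReal.one_le_ofReal]
  exact one_le_pow₀ one_le_two

/-- Averages of dilations close to the identity converge in `L²` on bounded sets. -/
theorem exists_dilatedAverage_approx [CompleteSpace F] {f : E d → F} (hf : StronglyMeasurable f)
    (hf2 : MemLp f 2 volume)
    {D : Set (E d)} (hD : Bornology.IsBounded D) (hDm : MeasurableSet D) (z : E d) {ε : ℝ≥0∞}
    (hε : ε ≠ 0) :
    ∃ τ > 0, ∀ r : ℝ, 1 / 2 ≤ r → r ≤ 1 → 1 - r ≤ τ → ∀ (ν : Measure (E d)),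
      IsProbabilityMeasure ν → (∀ᵐ s ∂ν, ‖s‖ ≤ τ) →
      eLpNorm (dilatedAverage z r ν f - f) 2 (volume.restrict D) ≤ ε := by
  set B : ℝ≥0∞ := ENNReal.ofReal (2 ^ d) with hB
  have hBtop : B ≠ ⊤ := ENNReal.ofReal_ne_top
  have hη : ε / (3 * (B + 1)) ≠ 0 := by
    refine (ENNReal.div_pos hε ?_).ne'
    exact ENNReal.mul_ne_top (by norm_num) (ENNReal.add_ne_top.2 ⟨hBtop, by norm_num⟩)
  -- A compactly supported continuous `g` is uniformly continuous, so its averages converge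
  -- uniformly on `D`; the remainder `f - g` is controlled by the uniform `L²` bound.
  obtain ⟨g, hgc, hfg, hgcont, hg2⟩ := hf2.exists_hasCompactSupport_eLpNorm_sub_le
    (by norm_num) hη
  have hgm : StronglyMeasurable g := hgcont.stronglyMeasurable
  set V : ℝ≥0∞ := (volume.restrict D) univ ^ (2 : ℝ≥0∞).toReal⁻¹ with hV
  have hVtop : V ≠ ⊤ := by
    refine ENNReal.rpow_ne_top_of_nonneg (by positivity) ?_
    rw [Measure.restrict_apply_univ]
    exact hD.measure_lt_top.ne
  obtain ⟨κ, hκ, hκV⟩ : ∃ κ : ℝ, 0 < κ ∧ V * ENNReal.ofReal κ ≤ ε / 3 :=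
    exists_pos_mul_ofReal_le hVtop (ENNReal.div_pos hε (by norm_num)).ne'
  obtain ⟨δ, hδ, hunif⟩ := Metric.uniformContinuous_iff.1
    (hgc.uniformContinuous_of_continuous hgcont) κ hκ
  obtain ⟨R, hR0, hR⟩ : ∃ R : ℝ, 0 < R ∧ ∀ y ∈ D, ‖y - z‖ ≤ R := by
    obtain ⟨R, hR0, hR⟩ := hD.subset_closedBall_lt 0 z
    exact ⟨R, hR0, fun y hy => by simpa [dist_eq_norm] using hR hy⟩
  -- On `D`, dilation and translation together move a point by at most `τ * R + τ = δ / 2`.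
  refine ⟨δ / (2 * (R + 1)), by positivity, fun r hr hr1 hτ ν hν hsupp => ?_⟩
  set τ := δ / (2 * (R + 1)) with hτd
  have hτδ : τ * R + τ < δ := by
    rw [hτd]
    have : δ / (2 * (R + 1)) * R + δ / (2 * (R + 1)) = δ / 2 := by field_simp
    linarith
  have hclose : ∀ y ∈ D, ‖dilatedAverage z r ν g y - g y‖ ≤ κ := by
    intro y hy
    have hae : ∀ᵐ s ∂ν, ‖g (z + r • (y - z) - s) - g y‖ ≤ κ := by
      filter_upwards [hsupp] with s hs
      rw [← dist_eq_norm]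
      refine (hunif ?_).le
      rw [dist_eq_norm]
      have e1 : z + r • (y - z) - s - y = -((1 - r) • (y - z)) - s := by
        rw [sub_smul, one_smul]; abel
      rw [e1]
      calc _ ≤ ‖-((1 - r) • (y - z))‖ + ‖s‖ := norm_sub_le _ _
        _ = (1 - r) * ‖y - z‖ + ‖s‖ := by
          rw [norm_neg, norm_smul, Real.norm_eq_abs, abs_of_nonneg (by linarith)]
        _ ≤ τ * R + τ := by
          have := hR y hy
          gcongr
        _ < δ := hτδ
    have hint : Integrable (fun s => g (z + r • (y - z) - s)) ν := by
      obtain ⟨M, hM⟩ := hgcont.bounded_above_of_compact_support hgc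
      exact Integrable.of_bound
        (hgm.comp_measurable (by fun_prop)).aestronglyMeasurable M (ae_of_all _ fun s => hM _)
    have e2 : dilatedAverage z r ν g y - g y = ∫ s, (g (z + r • (y - z) - s) - g y) ∂ν := by
      rw [integral_sub hint (integrable_const _)]
      simp [dilatedAverage]
    rw [e2]
    simpa using norm_integral_le_of_norm_le_const hae
  have hT2 : eLpNorm (dilatedAverage z r ν g - g) 2 (volume.restrict D) ≤ ε / 3 :=
    (eLpNorm_le_of_ae_bound (ae_restrict_of_forall_mem hDm hclose)).trans hκV
  have hT1 : eLpNorm (dilatedAverage z r ν (f - g)) 2 (volume.restrict D) ≤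
      B * (ε / (3 * (B + 1))) :=
    (eLpNorm_mono_measure _ Measure.restrict_le_self).trans <|
      (eLpNorm_dilatedAverage_le (hf.sub hgm) ν z hr).trans (by gcongr)
  have hT3 : eLpNorm (g - f) 2 (volume.restrict D) ≤ ε / (3 * (B + 1)) := by
    rw [eLpNorm_sub_comm]
    exact (eLpNorm_mono_measure _ Measure.restrict_le_self).trans hfg
  have hsum : dilatedAverage z r ν f - f =ᵐ[volume.restrict D]
      dilatedAverage z r ν (f - g) + (dilatedAverage z r ν g - g) + (g - f) := by
    refine ae_restrict_of_ae ?_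
    filter_upwards [ae_integrable_dilation hf hf2 ν z hr, ae_integrable_dilation hgm hg2 ν z hr]
      with y h1 h2
    simp only [Pi.add_apply, Pi.sub_apply, dilatedAverage]
    rw [integral_sub h1 h2]
    abel
  rw [eLpNorm_congr_ae hsum]
  have m1 := (stronglyMeasurable_dilatedAverage (hf.sub hgm) ν z r).aestronglyMeasurable
    (μ := volume.restrict D)
  have m2 := ((stronglyMeasurable_dilatedAverage hgm ν z r).sub hgm).aestronglyMeasurable
    (μ := volume.restrict D)
  have m3 := (hgm.sub hf).aestronglyMeasurable (μ := volume.restrict D)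
  refine (eLpNorm_add_le (m1.add m2) m3 one_le_two).trans ?_
  refine (add_le_add ((eLpNorm_add_le m1 m2 one_le_two).trans (add_le_add hT1 hT2)) hT3).trans ?_
  have e3 : B * (ε / (3 * (B + 1))) + ε / (3 * (B + 1)) = (B + 1) * (ε / (3 * (B + 1))) := by ring
  have e4 : (B + 1) * (ε / (3 * (B + 1))) ≤ ε / 3 := by
    rw [mul_comm 3, ENNReal.div_eq_inv_mul, ENNReal.mul_inv (by simp) (by simp), mul_assoc,
      ← mul_assoc (B + 1), ENNReal.div_eq_inv_mul]
    exact mul_le_of_le_one_left zero_le (ENNReal.mul_inv_le_one _)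
  calc _ = (B * (ε / (3 * (B + 1))) + ε / (3 * (B + 1))) + ε / 3 := by ring
    _ ≤ ε / 3 + ε / 3 := by rw [e3]; gcongr
    _ ≤ ε / 3 + ε / 3 + ε / 3 := le_self_add
    _ = ε := ENNReal.add_thirds ε

end Averages

/-! ### Mollification -/

section Mollification

variable {d : ℕ} (φ : ContDiffBump (0 : E d))

/-- The probability measure whose density is the normalized bump function `φ`. -/
noncomputable def bumpMeasure : Measure (E d) :=
  volume.withDensity fun s => ENNReal.ofReal (φ.normed volume s)

theorem measurable_bumpDensity :
    Measurable fun s : E d => ENNReal.ofReal (φ.normed volume s) :=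
  φ.continuous_normed.measurable.ennreal_ofReal

instance isProbabilityMeasure_bumpMeasure : IsProbabilityMeasure (bumpMeasure φ) := by
  refine ⟨?_⟩
  rw [bumpMeasure, withDensity_apply _ MeasurableSet.univ, setLIntegral_univ,
    ← ofReal_integral_eq_lintegral_ofReal φ.integrable_normed (ae_of_all _ φ.nonneg_normed),
    φ.integral_normed, ENNReal.ofReal_one]

theorem ae_bumpMeasure_norm_le : ∀ᵐ s ∂(bumpMeasure φ), ‖s‖ ≤ φ.rOut := by
  rw [bumpMeasure, ae_withDensity_iff (measurable_bumpDensity φ)]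
  refine ae_of_all _ fun s hs => ?_
  have : s ∈ Function.support (φ.normed volume) := fun h => hs (by rw [h, ENNReal.ofReal_zero])
  rw [φ.support_normed_eq, mem_ball_zero_iff] at this
  exact this.le

theorem integral_bumpMeasure {F : Type*} [NormedAddCommGroup F] [NormedSpace ℝ F] (g : E d → F) :
    ∫ s, g s ∂(bumpMeasure φ) = ∫ s, φ.normed volume s • g s := by
  rw [bumpMeasure, integral_withDensity_eq_integral_toReal_smul (measurable_bumpDensity φ)
    (ae_of_all _ fun _ => ENNReal.ofReal_lt_top)]
  simp only [ENNReal.toReal_ofReal (φ.nonneg_normed _)]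

theorem integrable_bumpMeasure {F : Type*} [NormedAddCommGroup F] [NormedSpace ℝ F]
    {g : E d → F} (hg : LocallyIntegrable g volume) (x : E d) :
    Integrable (fun s => g (x - s)) (bumpMeasure φ) := by
  rw [bumpMeasure, integrable_withDensity_iff_integrable_smul' (measurable_bumpDensity φ)
    (ae_of_all _ fun _ => ENNReal.ofReal_lt_top)]
  simp only [ENNReal.toReal_ofReal (φ.nonneg_normed _)]
  exact φ.hasCompactSupport_normed.convolutionExists_left (ContinuousLinearMap.lsmul ℝ ℝ)
    φ.continuous_normed hg x

open scoped Convolution in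
/-- The mollification of `v` by the normalized bump function `φ`. -/
noncomputable def mollify (v : E d → ℝ) : E d → ℝ :=
  v ⋆[ContinuousLinearMap.mul ℝ ℝ, volume] (φ.normed volume)

theorem contDiff_mollify {v : E d → ℝ} (hv : LocallyIntegrable v volume) :
    ContDiff ℝ ∞ (mollify φ v) :=
  φ.hasCompactSupport_normed.contDiff_convolution_right _ hv φ.contDiff_normed

theorem mollify_eq (v : E d → ℝ) (x : E d) :
    mollify φ v x = ∫ s, v (x - s) ∂(bumpMeasure φ) := by
  rw [mollify, convolution_mul_swap, integral_bumpMeasure]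
  simp only [smul_eq_mul, mul_comm]

/-- The derivative falls on the kernel; as the kernel centred at `x` is a test function supported in
`D`, the weak gradient moves it back onto `v`. -/
theorem hasGradientAt_mollify {D : Set (E d)} (hD : IsOpen D) {v : E d → ℝ} {G : E d → E d}
    (hH : MemH1 D v G) {x : E d} (hx : Metric.closedBall x φ.rOut ⊆ D) :
    HasGradientAt (mollify φ (D.indicator v)) (∫ s, D.indicator G (x - s) ∂(bumpMeasure φ)) x := by
  set k := φ.normed volume with hk
  have hkc : ContDiff ℝ ∞ k := φ.contDiff_normed
  have hks : HasCompactSupport k := φ.hasCompactSupport_normed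
  have hv : LocallyIntegrable (D.indicator v) volume :=
    ((memLp_indicator_iff_restrict hD.measurableSet).2 hH.memLp).locallyIntegrable one_le_two
  have hG : LocallyIntegrable (D.indicator G) volume :=
    ((memLp_indicator_iff_restrict hD.measurableSet).2 hH.memLp_grad).locallyIntegrable one_le_two
  have hfd := hks.hasFDerivAt_convolution_right (ContinuousLinearMap.mul ℝ ℝ) hv
    (hkc.of_le (by norm_cast)) x
  rw [hasGradientAt_iff_hasFDerivAt]
  refine hfd.congr_fderiv (ContinuousLinearMap.ext fun w => Eq.symm ?_)
  rw [convolution_precompR_apply _ hv (hks.fderiv ℝ)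
    (hkc.continuous_fderiv (by simp)), convolution_mul, InnerProductSpace.toDual_apply_apply,
    real_inner_comm, ← integral_inner (integrable_bumpMeasure φ hG x), integral_bumpMeasure]
  set ψ : E d → ℝ := fun t => k (x - t) with hψ
  have hψc : ContDiff ℝ ∞ ψ := hkc.comp (contDiff_const.sub contDiff_id)
  have hψsub : tsupport ψ ⊆ Metric.closedBall x φ.rOut := by
    refine closure_minimal (fun t ht => ?_) Metric.isClosed_closedBall
    have : x - t ∈ Function.support (φ.normed volume) := ht
    rw [φ.support_normed_eq, mem_ball_zero_iff] at this
    rw [mem_closedBall_iff_norm']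
    exact this.le
  have hψs : HasCompactSupport ψ :=
    (isCompact_closedBall x φ.rOut).of_isClosed_subset (isClosed_tsupport _) hψsub
  have hψd : ∀ t, fderiv ℝ ψ t w = -fderiv ℝ k (x - t) w := fun t => by
    have h1 : HasFDerivAt (fun t : E d => x - t) (-ContinuousLinearMap.id ℝ (E d)) t :=
      (hasFDerivAt_id t).const_sub x
    have h2 := ((hkc.differentiable (by simp)) (x - t)).hasFDerivAt.comp t h1
    have h3 : fderiv ℝ ψ t = _ := h2.fderiv
    rw [h3]; simp
  have hweak := hH.hasWeakGradient ψ hψc hψs (hψsub.trans hx) w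
  simp only [hψd, mul_neg, integral_neg, neg_inj] at hweak
  have e1 : ∫ t, D.indicator v t * fderiv ℝ k (x - t) w =
      ∫ t in D, v t * fderiv ℝ k (x - t) w := by
    rw [← integral_indicator hD.measurableSet]
    congr 1; ext t
    by_cases ht : t ∈ D <;> simp [ht]
  have e2 : ∫ t in D, inner ℝ (G t) w * ψ t =
      ∫ t, k (x - t) * inner ℝ w (D.indicator G t) := by
    rw [← integral_indicator hD.measurableSet]
    congr 1; ext t
    by_cases ht : t ∈ D
    · simp [ht, hψ, real_inner_comm, mul_comm]
    · simp [ht]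
  rw [e1, hweak, e2, ← integral_sub_left_eq_self _ volume x]
  simp only [sub_sub_cancel, smul_eq_mul]
  rfl

end Mollification

/-! ### Density of smooth functions in `H¹` of a star-shaped set -/

/-- Dilation towards `z` sends `closure D` to a compact subset of `D`. This leaves room for
mollification there with no extension of `v` beyond `D` other than by zero, and the zero extension
is never seen by the gradient. -/
theorem exists_smooth_approx_of_stronglyMeasurable {d : ℕ} {D : Set (E d)} (hD : IsOpen D)
    (hDb : Bornology.IsBounded D) {z : E d}
    (hstar : ∀ y ∈ closure D, ∀ t ∈ Ico (0 : ℝ) 1, z + t • (y - z) ∈ D)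
    {v : E d → ℝ} {G : E d → E d} (hvm : StronglyMeasurable v) (hGm : StronglyMeasurable G)
    (hH : MemH1 D v G) {ε : ℝ≥0∞} (hε : ε ≠ 0) :
    ∃ u : E d → ℝ, ContDiff ℝ ∞ u ∧ eLpNorm (u - v) 2 (volume.restrict D) ≤ ε ∧
      eLpNorm (∇ u - G) 2 (volume.restrict D) ≤ ε := by
  set v' := D.indicator v with hv'
  set G' := D.indicator G with hG'
  have hv'm : StronglyMeasurable v' := hvm.indicator hD.measurableSet
  have hG'm : StronglyMeasurable G' := hGm.indicator hD.measurableSet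
  have hv'2 : MemLp v' 2 volume := (memLp_indicator_iff_restrict hD.measurableSet).2 hH.memLp
  have hG'2 : MemLp G' 2 volume := (memLp_indicator_iff_restrict hD.measurableSet).2 hH.memLp_grad
  have hε2 : ε / 2 ≠ 0 := (ENNReal.half_pos hε).ne'
  obtain ⟨τ₁, hτ₁, h₁⟩ := exists_dilatedAverage_approx hv'm hv'2 hDb hD.measurableSet z hε
  obtain ⟨τ₂, hτ₂, h₂⟩ := exists_dilatedAverage_approx hG'm hG'2 hDb hD.measurableSet z hε2
  obtain ⟨ρ, hρ, hρG⟩ := exists_pos_mul_ofReal_le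
    (V := eLpNorm G 2 (volume.restrict D)) hH.memLp_grad.2.ne hε2
  set q : ℝ := min (min τ₁ τ₂) (min ρ (1 / 2)) with hq
  have hq0 : 0 < q := lt_min (lt_min hτ₁ hτ₂) (lt_min hρ (by norm_num))
  have hq1 : q ≤ 1 / 2 := (min_le_right _ _).trans (min_le_right _ _)
  have hqρ : q ≤ ρ := (min_le_right _ _).trans (min_le_left _ _)
  have hqτ₁ : q ≤ τ₁ := (min_le_left _ _).trans (min_le_left _ _)
  have hqτ₂ : q ≤ τ₂ := (min_le_left _ _).trans (min_le_right _ _)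
  set r : ℝ := 1 - q with hr
  have hr2 : 1 / 2 ≤ r := by linarith
  have hr1 : r < 1 := by linarith
  set S : E d → E d := fun y => z + r • (y - z) with hS
  have hScont : Continuous S := by fun_prop
  obtain ⟨δ, hδ, hδD⟩ := (hDb.isCompact_closure.image hScont).exists_cthickening_subset_open hD
    (by rintro _ ⟨y, hy, rfl⟩; exact hstar y hy r ⟨by linarith, hr1⟩)
  set R : ℝ := min δ (min τ₁ τ₂) with hR
  have hR0 : 0 < R := lt_min hδ (lt_min hτ₁ hτ₂)
  let φ : ContDiffBump (0 : E d) := ⟨R / 2, R, by linarith, by linarith⟩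
  have hball : ∀ y ∈ D, Metric.closedBall (S y) φ.rOut ⊆ D := fun y hy =>
    (Metric.closedBall_subset_closedBall (min_le_left δ _)).trans
      ((Metric.closedBall_subset_cthickening (mem_image_of_mem S (subset_closure hy)) δ).trans hδD)
  have hν := ae_bumpMeasure_norm_le φ
  have hν₁ : ∀ᵐ s ∂(bumpMeasure φ), ‖s‖ ≤ τ₁ :=
    hν.mono fun s hs => hs.trans ((min_le_right _ _).trans (min_le_left _ _))
  have hν₂ : ∀ᵐ s ∂(bumpMeasure φ), ‖s‖ ≤ τ₂ :=
    hν.mono fun s hs => hs.trans ((min_le_right _ _).trans (min_le_right _ _))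
  have hSd : ContDiff ℝ ∞ S := by fun_prop
  refine ⟨mollify φ v' ∘ S, (contDiff_mollify φ (hv'2.locallyIntegrable one_le_two)).comp hSd,
    ?_, ?_⟩
  · refine le_of_eq_of_le (eLpNorm_congr_ae (ae_restrict_of_forall_mem hD.measurableSet
      fun y hy => ?_)) (h₁ r hr2 hr1.le (by linarith) (bumpMeasure φ) inferInstance hν₁)
    simp only [Pi.sub_apply, Function.comp_apply, mollify_eq, dilatedAverage, hv',
      indicator_of_mem hy]
    rfl
  · have hgrad : ∀ y ∈ D, ∇ (mollify φ v' ∘ S) y = r • dilatedAverage z r (bumpMeasure φ) G' y := by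
      intro y hy
      have h1 := (hasGradientAt_mollify φ hD hH (hball y hy)).hasFDerivAt
      have h2 : HasFDerivAt S (r • ContinuousLinearMap.id ℝ (E d)) y :=
        (((hasFDerivAt_id y).sub_const z).const_smul r).const_add z
      refine HasGradientAt.gradient ?_
      rw [hasGradientAt_iff_hasFDerivAt]
      refine (h1.comp y h2).congr_fderiv (ContinuousLinearMap.ext fun w => ?_)
      simp [dilatedAverage, hS, hG']
    -- The chain rule gives a factor `r = 1 - q` on the averaged gradient; the resulting error `q •
    -- G` is small because `q ≤ ρ`.
    have hdec : ∇ (mollify φ v' ∘ S) - G =ᵐ[volume.restrict D]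
        r • (dilatedAverage z r (bumpMeasure φ) G' - G') + (-q) • G := by
      refine ae_restrict_of_forall_mem hD.measurableSet fun y hy => ?_
      simp only [Pi.sub_apply, Pi.add_apply, Pi.smul_apply, hgrad y hy, hG', indicator_of_mem hy]
      rw [smul_sub, hr, sub_smul, sub_smul, one_smul, one_smul, neg_smul]
      abel
    rw [eLpNorm_congr_ae hdec]
    have m1 := (((stronglyMeasurable_dilatedAverage hG'm (bumpMeasure φ) z r).sub
      hG'm).const_smul r).aestronglyMeasurable (μ := volume.restrict D)
    have m2 := (hGm.const_smul (-q)).aestronglyMeasurable (μ := volume.restrict D)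
    refine (eLpNorm_add_le m1 m2 one_le_two).trans ?_
    rw [eLpNorm_const_smul, eLpNorm_const_smul, enorm_neg, ← ENNReal.add_halves ε]
    refine add_le_add ?_ ?_
    · refine (mul_le_of_le_one_left zero_le ?_).trans
        (h₂ r hr2 hr1.le (by linarith) (bumpMeasure φ) inferInstance hν₂)
      rw [Real.enorm_of_nonneg (by linarith), ENNReal.ofReal_le_one]
      exact hr1.le
    · rw [mul_comm, Real.enorm_of_nonneg hq0.le]
      exact (mul_le_mul_right (ENNReal.ofReal_le_ofReal hqρ) _).trans hρG

theorem MemH1.congr_ae {d : ℕ} {D : Set (E d)} {v v' : E d → ℝ} {G G' : E d → E d}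
    (hH : MemH1 D v G) (hv : v =ᵐ[volume.restrict D] v') (hG : G =ᵐ[volume.restrict D] G') :
    MemH1 D v' G' := by
  refine ⟨(memLp_congr_ae hv).1 hH.memLp, (memLp_congr_ae hG).1 hH.memLp_grad,
    fun φ h1 h2 h3 w => ?_⟩
  have := hH.hasWeakGradient φ h1 h2 h3 w
  have e1 : ∫ x in D, v x * fderiv ℝ φ x w = ∫ x in D, v' x * fderiv ℝ φ x w :=
    integral_congr_ae (hv.mono fun x hx => by simp only [hx])
  have e2 : ∫ x in D, inner ℝ (G x) w * φ x = ∫ x in D, inner ℝ (G' x) w * φ x :=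
    integral_congr_ae (hG.mono fun x hx => by simp only [hx])
  rwa [e1, e2] at this

/-- Smooth functions are dense in `H¹(D)` if `D` is bounded, open, and strictly star-shaped. -/
theorem exists_smooth_approx {d : ℕ} {D : Set (E d)} (hD : IsOpen D)
    (hDb : Bornology.IsBounded D) {z : E d}
    (hstar : ∀ y ∈ closure D, ∀ t ∈ Ico (0 : ℝ) 1, z + t • (y - z) ∈ D)
    {v : E d → ℝ} {G : E d → E d} (hH : MemH1 D v G) {ε : ℝ≥0∞} (hε : ε ≠ 0) :
    ∃ u : E d → ℝ, ContDiff ℝ ∞ u ∧ eLpNorm (u - v) 2 (volume.restrict D) ≤ ε ∧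
      eLpNorm (∇ u - G) 2 (volume.restrict D) ≤ ε := by
  obtain ⟨v', hv'm, hv'⟩ := hH.memLp.1
  obtain ⟨G', hG'm, hG'⟩ := hH.memLp_grad.1
  obtain ⟨u, hu, h1, h2⟩ := exists_smooth_approx_of_stronglyMeasurable hD hDb hstar hv'm hG'm
    (hH.congr_ae hv' hG') hε
  refine ⟨u, hu, le_of_eq_of_le (eLpNorm_congr_ae ?_) h1, le_of_eq_of_le (eLpNorm_congr_ae ?_) h2⟩
  · exact hv'.mono fun x hx => by simp only [Pi.sub_apply, hx]
  · exact hG'.mono fun x hx => by simp only [Pi.sub_apply, hx]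

/-! ### Traces of `H¹` functions -/

theorem gradient_sub {d : ℕ} {u w : E d → ℝ} (hu : ContDiff ℝ ∞ u) (hw : ContDiff ℝ ∞ w) :
    ∇ (u - w) = ∇ u - ∇ w := by
  ext1 x
  simp only [gradient, Pi.sub_apply]
  rw [fderiv_sub (hu.differentiable (by simp) x) (hw.differentiable (by simp) x), map_sub]

theorem tendsto_traceBound {ι : Type*} {l : Filter ι} (α β : ℝ≥0∞) (hα : α ≠ ⊤) (hβ : β ≠ ⊤)
    {a b : ι → ℝ≥0∞} {a₀ b₀ : ℝ≥0∞} (ha₀ : a₀ ≠ ⊤) (hb₀ : b₀ ≠ ⊤) (ha : Tendsto a l (𝓝 a₀))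
    (hb : Tendsto b l (𝓝 b₀)) :
    Tendsto (fun k => β * (α * a k + a k ^ (1 / 2 : ℝ) * b k ^ (1 / 2 : ℝ))) l
      (𝓝 (β * (α * a₀ + a₀ ^ (1 / 2 : ℝ) * b₀ ^ (1 / 2 : ℝ)))) := by
  have hhalf : (0 : ℝ) ≤ 1 / 2 := by norm_num
  refine ENNReal.Tendsto.const_mul (Tendsto.add (ENNReal.Tendsto.const_mul ha (Or.inr hα)) ?_)
    (Or.inr hβ)
  exact ENNReal.Tendsto.mul (ha.ennrpow_const _)
    (Or.inr (ENNReal.rpow_ne_top_of_nonneg hhalf hb₀)) (hb.ennrpow_const _)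
    (Or.inr (ENNReal.rpow_ne_top_of_nonneg hhalf ha₀))

theorem rpow_half_mul_self (a : ℝ≥0∞) : a ^ (1 / 2 : ℝ) * a ^ (1 / 2 : ℝ) = a := by
  rw [← ENNReal.rpow_add_of_nonneg _ _ (by norm_num) (by norm_num)]
  norm_num

section Trace

variable {d : ℕ} {D e : Set (E d)} {α β : ℝ≥0∞}

/-- The smooth estimate passes to the limit along whichever approximating sequence defines the
trace, so the bound holds for every trace. -/
theorem eLpNorm_trace_le (hα : α ≠ ⊤) (hβ : β ≠ ⊤)
    (hest : ∀ u : E d → ℝ, ContDiff ℝ ∞ u → eLpNorm u 2 (surfaceMeasure e) ≤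
      β * (α * eLpNorm u 2 (volume.restrict D) + eLpNorm u 2 (volume.restrict D) ^ (1 / 2 : ℝ) *
        eLpNorm (∇ u) 2 (volume.restrict D) ^ (1 / 2 : ℝ)))
    {v : E d → ℝ} {G : E d → E d} (hH : MemH1 D v G) {g : E d → ℝ} (hg : IsTrace D e v G g) :
    eLpNorm g 2 (surfaceMeasure e) ≤
      β * (α * eLpNorm v 2 (volume.restrict D) + eLpNorm v 2 (volume.restrict D) ^ (1 / 2 : ℝ) *
        eLpNorm G 2 (volume.restrict D) ^ (1 / 2 : ℝ)) := by
  obtain ⟨hg2, u, hu, h1, h2, h3⟩ := hg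
  have hgc : ∀ n, Continuous (∇ (u n)) := fun n =>
    continuous_gradient ((hu n).of_le (by norm_cast))
  have hbound : ∀ n, eLpNorm g 2 (surfaceMeasure e) ≤ eLpNorm (u n - g) 2 (surfaceMeasure e) +
      β * (α * (eLpNorm v 2 (volume.restrict D) + eLpNorm (u n - v) 2 (volume.restrict D)) +
        (eLpNorm v 2 (volume.restrict D) + eLpNorm (u n - v) 2 (volume.restrict D)) ^ (1 / 2 : ℝ) *
        (eLpNorm G 2 (volume.restrict D) +
          eLpNorm (∇ (u n) - G) 2 (volume.restrict D)) ^ (1 / 2 : ℝ)) := fun n => by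
    have e1 : g = -(u n - g) + u n := by abel
    have e2 : u n = v + (u n - v) := by abel
    have e3 : ∇ (u n) = G + (∇ (u n) - G) := by abel
    have hun : AEStronglyMeasurable (u n) (surfaceMeasure e) :=
      (hu n).continuous.aestronglyMeasurable
    have hun' : AEStronglyMeasurable (u n) (volume.restrict D) :=
      (hu n).continuous.aestronglyMeasurable
    have hgn' : AEStronglyMeasurable (∇ (u n)) (volume.restrict D) :=
      (hgc n).aestronglyMeasurable
    have n1 : eLpNorm g 2 (surfaceMeasure e) ≤
        eLpNorm (u n - g) 2 (surfaceMeasure e) + eLpNorm (u n) 2 (surfaceMeasure e) := by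
      conv_lhs => rw [e1]
      refine (eLpNorm_add_le (hun.sub hg2.1).neg hun one_le_two).trans_eq ?_
      rw [eLpNorm_neg]
    have n2 : eLpNorm (u n) 2 (volume.restrict D) ≤
        eLpNorm v 2 (volume.restrict D) + eLpNorm (u n - v) 2 (volume.restrict D) := by
      conv_lhs => rw [e2]
      exact eLpNorm_add_le hH.memLp.1 (hun'.sub hH.memLp.1) one_le_two
    have n3 : eLpNorm (∇ (u n)) 2 (volume.restrict D) ≤
        eLpNorm G 2 (volume.restrict D) + eLpNorm (∇ (u n) - G) 2 (volume.restrict D) := by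
      conv_lhs => rw [e3]
      exact eLpNorm_add_le hH.memLp_grad.1 (hgn'.sub hH.memLp_grad.1) one_le_two
    refine n1.trans (add_le_add le_rfl ((hest _ (hu n)).trans ?_))
    gcongr
  have hlim := h3.add (tendsto_traceBound α β hα hβ
    (a₀ := eLpNorm v 2 (volume.restrict D) + 0) (b₀ := eLpNorm G 2 (volume.restrict D) + 0)
    (by simpa using hH.memLp.2.ne) (by simpa using hH.memLp_grad.2.ne)
    (h1.const_add _) (h2.const_add _))
  simp only [add_zero, zero_add] at hlim
  exact ge_of_tendsto' hlim hbound

/-- Applied to differences, the smooth estimate turns an `H¹`-convergent sequence into a Cauchy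
sequence in `L²(e)`. -/
theorem exists_isTrace (hα : α ≠ ⊤) (hβ : β ≠ ⊤)
    (hest : ∀ u : E d → ℝ, ContDiff ℝ ∞ u → eLpNorm u 2 (surfaceMeasure e) ≤
      β * (α * eLpNorm u 2 (volume.restrict D) + eLpNorm u 2 (volume.restrict D) ^ (1 / 2 : ℝ) *
        eLpNorm (∇ u) 2 (volume.restrict D) ^ (1 / 2 : ℝ)))
    {v : E d → ℝ} {G : E d → E d} (hH : MemH1 D v G)
    (hdense : ∀ ε : ℝ≥0∞, ε ≠ 0 → ∃ u : E d → ℝ, ContDiff ℝ ∞ u ∧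
      eLpNorm (u - v) 2 (volume.restrict D) ≤ ε ∧ eLpNorm (∇ u - G) 2 (volume.restrict D) ≤ ε) :
    ∃ g, IsTrace D e v G g := by
  have hε0 : ∀ n : ℕ, (2⁻¹ : ℝ≥0∞) ^ n ≠ 0 := fun n => pow_ne_zero _ (by simp)
  have hεtop : ∀ n : ℕ, (2⁻¹ : ℝ≥0∞) ^ n ≠ ⊤ := fun n => ENNReal.pow_ne_top (by simp)
  have hε : Tendsto (fun n : ℕ => (2⁻¹ : ℝ≥0∞) ^ n) atTop (𝓝 0) :=
    ENNReal.tendsto_pow_atTop_nhds_zero_of_lt_one (by simp)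
  choose u hu h1 h2 using fun n : ℕ => hdense ((2⁻¹ : ℝ≥0∞) ^ n) (hε0 n)
  have hum : ∀ n, AEStronglyMeasurable (u n) (volume.restrict D) := fun n =>
    (hu n).continuous.aestronglyMeasurable
  have hgm : ∀ n, AEStronglyMeasurable (∇ (u n)) (volume.restrict D) := fun n =>
    (continuous_gradient ((hu n).of_le (by norm_cast))).aestronglyMeasurable
  have hmem : ∀ n, MemLp (u n) 2 (surfaceMeasure e) := fun n => by
    refine ⟨(hu n).continuous.aestronglyMeasurable, (hest _ (hu n)).trans_lt ?_⟩
    have f1 : eLpNorm (u n) 2 (volume.restrict D) ≠ ⊤ := by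
      have : MemLp (u n - v) 2 (volume.restrict D) :=
        ⟨(hum n).sub hH.memLp.1, (h1 n).trans_lt (hεtop n).lt_top⟩
      simpa using (this.add hH.memLp).2.ne
    have f2 : eLpNorm (∇ (u n)) 2 (volume.restrict D) ≠ ⊤ := by
      have : MemLp (∇ (u n) - G) 2 (volume.restrict D) :=
        ⟨(hgm n).sub hH.memLp_grad.1, (h2 n).trans_lt (hεtop n).lt_top⟩
      simpa using (this.add hH.memLp_grad).2.ne
    have hhalf : (0 : ℝ) ≤ 1 / 2 := by norm_num
    exact (ENNReal.mul_ne_top hβ (ENNReal.add_ne_top.2 ⟨ENNReal.mul_ne_top hα f1,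
      ENNReal.mul_ne_top (ENNReal.rpow_ne_top_of_nonneg hhalf f1)
        (ENNReal.rpow_ne_top_of_nonneg hhalf f2)⟩)).lt_top
  -- The summand `1` in the coefficient adds a spare `2⁻¹ ^ N`, which makes the Cauchy bound strict
  -- even if `β = 0`.
  set B : ℕ → ℝ≥0∞ := fun N => (β * (α + 1) * 2 + 1) * (2⁻¹ : ℝ≥0∞) ^ N with hB
  have hB' : ∑' N, B N ≠ ⊤ := by
    rw [hB, ENNReal.tsum_mul_left, ENNReal.tsum_geometric, ENNReal.one_sub_inv_two, inv_inv]
    exact ENNReal.mul_ne_top (ENNReal.add_ne_top.2 ⟨ENNReal.mul_ne_top (ENNReal.mul_ne_top hβ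
      (ENNReal.add_ne_top.2 ⟨hα, by simp⟩)) (by simp), by simp⟩) (by simp)
  have hcau : ∀ N n m : ℕ, N ≤ n → N ≤ m →
      eLpNorm (u n - u m) 2 (surfaceMeasure e) < B N := by
    intro N n m hn hm
    have hle : ∀ k, N ≤ k → (2⁻¹ : ℝ≥0∞) ^ k ≤ (2⁻¹ : ℝ≥0∞) ^ N := fun k hk =>
      pow_le_pow_of_le_one zero_le (by simp) hk
    have k1 : eLpNorm (u n - u m) 2 (volume.restrict D) ≤ 2 * (2⁻¹ : ℝ≥0∞) ^ N := by
      have : u n - u m = (u n - v) - (u m - v) := by abel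
      rw [this, two_mul]
      exact (eLpNorm_sub_le ((hum n).sub hH.memLp.1) ((hum m).sub hH.memLp.1) one_le_two).trans
        (add_le_add ((h1 n).trans (hle n hn)) ((h1 m).trans (hle m hm)))
    have k2 : eLpNorm (∇ (u n - u m)) 2 (volume.restrict D) ≤ 2 * (2⁻¹ : ℝ≥0∞) ^ N := by
      have : ∇ (u n - u m) = (∇ (u n) - G) - (∇ (u m) - G) := by
        rw [gradient_sub (hu n) (hu m)]; abel
      rw [this, two_mul]
      exact (eLpNorm_sub_le ((hgm n).sub hH.memLp_grad.1) ((hgm m).sub hH.memLp_grad.1)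
        one_le_two).trans (add_le_add ((h2 n).trans (hle n hn)) ((h2 m).trans (hle m hm)))
    calc eLpNorm (u n - u m) 2 (surfaceMeasure e) ≤ _ := hest _ ((hu n).sub (hu m))
      _ ≤ β * (α * (2 * (2⁻¹ : ℝ≥0∞) ^ N) + (2 * (2⁻¹ : ℝ≥0∞) ^ N) ^ (1 / 2 : ℝ) *
          (2 * (2⁻¹ : ℝ≥0∞) ^ N) ^ (1 / 2 : ℝ)) := by gcongr
      _ = β * (α + 1) * 2 * (2⁻¹ : ℝ≥0∞) ^ N := by rw [rpow_half_mul_self]; ring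
      _ < β * (α + 1) * 2 * (2⁻¹ : ℝ≥0∞) ^ N + (2⁻¹ : ℝ≥0∞) ^ N := by
        refine ENNReal.lt_add_right (ENNReal.mul_ne_top (ENNReal.mul_ne_top (ENNReal.mul_ne_top hβ
          (ENNReal.add_ne_top.2 ⟨hα, by simp⟩)) (by simp)) (hεtop N)) (hε0 N)
      _ = B N := by rw [hB]; ring
  obtain ⟨g, hg, hlim⟩ := Lp.cauchy_complete_eLpNorm one_le_two hmem hB' hcau
  exact ⟨g, hg, u, hu, tendsto_of_tendsto_of_tendsto_of_le_of_le tendsto_const_nhds hε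
    (fun _ => zero_le) h1, tendsto_of_tendsto_of_tendsto_of_le_of_le tendsto_const_nhds hε
    (fun _ => zero_le) h2, hlim⟩

end Trace

/-! ### Elements of a mesh -/

section Elements

variable {d : ℕ} {K : Set (E d)}

theorem IsSimplex.isCompact (hK : IsSimplex K) : IsCompact K := by
  obtain ⟨a, -, rfl⟩ := hK
  exact (finite_range a).isCompact_convexHull ℝ

theorem IsSimplex.convex (hK : IsSimplex K) : Convex ℝ K := by
  obtain ⟨a, -, rfl⟩ := hK
  exact convex_convexHull ℝ _

theorem IsSimplex.nontrivial (hK : IsSimplex K) (hd : d ≠ 0) : K.Nontrivial := by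
  obtain ⟨a, ha, rfl⟩ := hK
  refine ⟨a 0, subset_convexHull ℝ _ (mem_range_self _), a (Fin.last d),
    subset_convexHull ℝ _ (mem_range_self _), fun h => ?_⟩
  exact hd (by simpa [Fin.ext_iff] using (ha.injective h).symm)

theorem IsParallelepiped.isCompact (hK : IsParallelepiped K) : IsCompact K := by
  obtain ⟨x₀, b, -, rfl⟩ := hK
  exact (isCompact_Icc.image (by fun_prop)).image (by fun_prop)

theorem IsParallelepiped.convex (hK : IsParallelepiped K) : Convex ℝ K := by
  obtain ⟨x₀, b, -, rfl⟩ := hK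
  have : Convex ℝ (parallelepiped b) := by
    rw [parallelepiped_eq_convexHull]; exact convex_convexHull ℝ _
  exact this.translate x₀

theorem IsParallelepiped.nontrivial (hK : IsParallelepiped K) (hd : d ≠ 0) : K.Nontrivial := by
  obtain ⟨x₀, b, hb, rfl⟩ := hK
  let i : Fin d := ⟨0, Nat.pos_of_ne_zero hd⟩
  refine ⟨x₀ + 0, mem_image_of_mem _ ((mem_parallelepiped_iff b 0).2 ⟨0, by simp, by simp⟩),
    x₀ + b i, mem_image_of_mem _ ((mem_parallelepiped_iff b (b i)).2
      ⟨Pi.single i 1, ⟨?_, ?_⟩, ?_⟩), fun h => hb.ne_zero i (add_left_cancel h).symm⟩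
  · exact Pi.single_nonneg.2 zero_le_one
  · intro j
    by_cases hj : j = i
    · subst hj; simp
    · simp [Pi.single_eq_of_ne hj]
  · simp [Pi.single_apply]

theorem IsConformingMesh.isCompact {Ω : Set (E d)} {M : Set (Set (E d))}
    (hM : IsConformingMesh Ω M) (hK : K ∈ M) : IsCompact K :=
  (hM.element K hK).elim IsSimplex.isCompact IsParallelepiped.isCompact

theorem IsConformingMesh.convex {Ω : Set (E d)} {M : Set (Set (E d))}
    (hM : IsConformingMesh Ω M) (hK : K ∈ M) : Convex ℝ K :=
  (hM.element K hK).elim IsSimplex.convex IsParallelepiped.convex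

theorem IsConformingMesh.diam_pos {Ω : Set (E d)} {M : Set (Set (E d))}
    (hM : IsConformingMesh Ω M) (hK : K ∈ M) (hd : d ≠ 0) : 0 < Metric.diam K :=
  Metric.diam_pos ((hM.element K hK).elim (fun h => h.nontrivial hd) (fun h => h.nontrivial hd))
    (hM.isCompact hK).isBounded

theorem IsConformingMesh.diam_le {Ω : Set (E d)} {M : Set (Set (E d))}
    (hM : IsConformingMesh Ω M) (hK : K ∈ M) : Metric.diam K ≤ meshSize M :=
  le_csSup (hM.finite.image _).bddAbove (mem_image_of_mem _ hK)

theorem IsInterfacePiece.subset {Γ e : Set (E d)} {M : Set (Set (E d))}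
    (h : IsInterfacePiece Γ M K e) : e ⊆ Γ ∩ K := by
  rcases h.2 with ⟨-, rfl⟩ | ⟨K', -, -, rfl, hΓ, -⟩
  · exact subset_rfl
  · exact fun x hx => ⟨hΓ hx, hx.1⟩

theorem IsInterfacePiece.nonempty {Γ e : Set (E d)} {M : Set (Set (E d))}
    (h : IsInterfacePiece Γ M K e) (hd : 2 ≤ d) : e.Nonempty := by
  rcases h.2 with ⟨⟨x, hx⟩, rfl⟩ | ⟨K', -, -, -, -, hrank⟩
  · exact ⟨x, hx.1, interior_subset hx.2⟩
  · rw [nonempty_iff_ne_empty]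
    -- The empty set has a direction space of dimension `0`, which would give `d = 1`.
    rintro rfl
    rw [vectorSpan_empty, finrank_bot] at hrank
    omega

theorem IsInterfacePiece.isCompact {Ω Γ e : Set (E d)} {M : Set (Set (E d))}
    (h : IsInterfacePiece Γ M K e) (hM : IsConformingMesh Ω M) (hΓ : IsCompact Γ) :
    IsCompact e := by
  rcases h.2 with ⟨-, rfl⟩ | ⟨K', hK', -, rfl, -, -⟩
  · exact hΓ.inter (hM.isCompact h.1)
  · exact (hM.isCompact h.1).inter (hM.isCompact hK')

end Elements

end Interface

/-! ### The trace and inverse inequalities on interface pieces -/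

theorem lemma1 (d : ℕ) (hd : d = 2 ∨ d = 3) (Γ : Set (Interface.E d))
    (hΓ : Interface.IsC2Hypersurface Γ) (σ : ℝ) (hσ : 0 < σ) :
    ∃ h₀ : ℝ, 0 < h₀ ∧ ∃ C : ℝ, 0 < C ∧
      ∀ (Ω : Set (Interface.E d)) (Ωs : Fin 2 → Set (Interface.E d)),
      Interface.IsInterfaceSplitting Ω Ωs Γ →
      ∀ M : Set (Set (Interface.E d)), Interface.IsConformingMesh Ω M →
      Interface.IsShapeRegular σ M → Interface.meshSize M ≤ h₀ →
      ∀ K e : Set (Interface.E d), Interface.IsInterfacePiece Γ M K e →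
      ∃ i : Fin 2,
        (∀ (v : Interface.E d → ℝ) (G : Interface.E d → Interface.E d),
          Interface.MemH1 (interior (K ∩ Ωs i)) v G →
          (∃ g, Interface.IsTrace (interior (K ∩ Ωs i)) e v G g) ∧
          ∀ g, Interface.IsTrace (interior (K ∩ Ωs i)) e v G g →
            eLpNorm g 2 (Interface.surfaceMeasure e) ≤
              ENNReal.ofReal C *
                (ENNReal.ofReal (Metric.diam K ^ (-(1 / 2) : ℝ)) *
                    eLpNorm v 2 (volume.restrict (K ∩ Ωs i)) +
                  eLpNorm v 2 (volume.restrict (K ∩ Ωs i)) ^ (1 / 2 : ℝ) *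
                    eLpNorm G 2 (volume.restrict (K ∩ Ωs i)) ^ (1 / 2 : ℝ))) ∧
        (∀ p : ℕ, 1 ≤ p → ∀ v : Interface.E d → ℝ, Interface.IsLocalPolynomial K p v →
          eLpNorm v 2 (Interface.surfaceMeasure e) ≤
            ENNReal.ofReal (C * (p / Metric.diam K ^ (1 / 2 : ℝ))) *
              eLpNorm v 2 (volume.restrict (K ∩ Ωs i))) := by
  -- The constants are chosen before the splitting, yet they need `Γ` compact. One splitting
  -- suffices for that, and with none the claim is vacuous.
  by_cases hex : ∃ (Ω : Set (Interface.E d)) (Ωs : Fin 2 → Set (Interface.E d)),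
      Interface.IsInterfaceSplitting Ω Ωs Γ
  swap
  · exact ⟨1, one_pos, 1, one_pos, fun Ω Ωs S => (hex ⟨Ω, Ωs, S⟩).elim⟩
  obtain ⟨Ω₀, Ωs₀, S₀⟩ := hex
  have hΓc := S₀.isCompact_interface
  obtain ⟨m, rfl, hm1, hm2⟩ : ∃ m, d = m + 1 ∧ 1 ≤ m ∧ m ≤ 2 := by
    rcases hd with rfl | rfl
    exacts [⟨1, rfl, le_rfl, one_le_two⟩, ⟨2, rfl, one_le_two, le_rfl⟩]
  obtain ⟨δ, hδ, hflat⟩ := hΓ.exists_uniform_normal hΓc (ε := 1 / (16 * σ)) (by positivity)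
  set c : ℝ := 1 / (8 * σ) with hc
  have hcpos : 0 < c := by positivity
  set A : ℝ := 2 ^ m / c ^ (m + 1) with hA
  have hApos : 0 < A := by positivity
  -- Chosen so that `C ^ 2 = 50 * (m + 1) * A` dominates both `2 * (m + 1) * A`, for the trace
  -- inequality, and `25 * A`, for the polynomial one.
  set C : ℝ := 5 * √(2 * (m + 1) * A) with hC
  have hCpos : 0 < C := by positivity
  have hC2 : C ^ 2 = 25 * (2 * (m + 1) * A) := by
    rw [hC, mul_pow, Real.sq_sqrt (by positivity)]; norm_num
  have hm0 : (0 : ℝ) ≤ m * A := by positivity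
  -- Half of `δ`, so that an element lies in the open ball of radius `δ` about any of its points.
  refine ⟨δ / 2, by positivity, C, hCpos, ?_⟩
  intro Ω Ωs S M hM hreg hsize K e he
  have hKM := he.1
  have hKc := hM.isCompact hKM
  have hKconv := hM.convex hKM
  have hdiam := hM.diam_pos hKM m.succ_ne_zero
  have hKΩ : K ⊆ closure Ω := hM.cover ▸ subset_sUnion_of_mem hKM
  obtain ⟨x₀, hx₀e⟩ := he.nonempty (by omega)
  have hx₀ := he.subset hx₀e
  obtain ⟨n, hn, hnflat⟩ := hflat x₀ hx₀.1
  have hball : Γ ∩ K ⊆ Γ ∩ Metric.ball x₀ δ := fun x hx => by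
    refine ⟨hx.1, ?_⟩
    have h1 := Metric.dist_le_diam_of_mem hKc.isBounded hx.2 hx₀.2
    have h2 := hM.diam_le hKM
    rw [Metric.mem_ball]
    linarith
  obtain ⟨b, hb⟩ := hreg K hKM
  obtain ⟨z, hz, n', T⟩ := Interface.exists_isTransversal hσ hKc.isBounded hdiam hb hn hx₀
    fun x hx y hy => hnflat x (hball hx) y (hball hy)
  -- The side is dictated by the point of view: the part of `Ω` containing `z`.
  obtain ⟨i, hzi⟩ := S.exists_mem_part (S.interior_subset hKΩ hz)
    fun hzΓ => T.notMem ⟨hzΓ, interior_subset hz⟩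
  have hint : interior (K ∩ Ωs i) = interior K ∩ Ωs i := by
    rw [interior_inter, (S.isOpen_part i).interior_eq]
  have hDo : IsOpen (interior (K ∩ Ωs i)) := isOpen_interior
  have hDb : Bornology.IsBounded (interior (K ∩ Ωs i)) :=
    hKc.isBounded.subset (interior_subset.trans inter_subset_left)
  have hstar : ∀ y ∈ closure (interior (K ∩ Ωs i)), ∀ t ∈ Ico (0 : ℝ) 1,
      z + t • (y - z) ∈ interior (K ∩ Ωs i) := by
    rw [hint]
    exact fun y hy t ht =>
      Interface.starShaped_closure S hKΩ hKconv hKc.isClosed T hz hzi hy ht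
  have hcone : ∀ x ∈ e, ∀ t ∈ Ioo (0 : ℝ) 1, z + t • (x - z) ∈ interior (K ∩ Ωs i) := by
    rw [hint]
    exact fun x hx t ht => Interface.cone_subset S hKΩ hKconv T hz hzi (he.subset hx)
      (Ioo_subset_Ico_self ht)
  have Te := T.mono he.subset
  have hec := he.isCompact hM hΓc
  have hmono : volume.restrict (interior (K ∩ Ωs i)) ≤ volume.restrict (K ∩ Ωs i) :=
    Measure.restrict_mono interior_subset le_rfl
  have hest : ∀ u : Interface.E (m + 1) → ℝ, ContDiff ℝ ∞ u → _ := fun u hu =>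
    Te.eLpNorm_le hec hDo.measurableSet hcone (hu.of_le (by norm_cast)) hCpos.le
      (by rw [hC2]; nlinarith)
  refine ⟨i, fun v G hH => ⟨?_, fun g hg => ?_⟩, fun p hp v hv => ?_⟩
  · exact Interface.exists_isTrace ENNReal.ofReal_ne_top ENNReal.ofReal_ne_top hest hH
      fun ε hε => Interface.exists_smooth_approx hDo hDb hstar hH hε
  · refine (Interface.eLpNorm_trace_le ENNReal.ofReal_ne_top ENNReal.ofReal_ne_top hest hH
      hg).trans ?_
    gcongr
  · refine (Te.eLpNorm_polynomial_le hec hDo.measurableSet hcone hm2 hp hv hCpos.le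
      (by rw [hC2]; nlinarith)).trans ?_
    gcongr
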